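/- Let $n\ge 1$, and let $D\subset\mathbb C^n$ be a bounded $\mathcal C^2$-smooth strongly convex domain containing the origin; that is, $D$ is open, connected and bounded, $0\in D$, and $D=\{r<0\}$ for some $r\in\mathcal C^2(\mathbb C^n,\mathbb R)$ such that at every point of the boundary of $D$ one has $dr\neq0$ and the real Hessian of $r$ is positive definite on the real tangent space $\ker dr$. Let $m_D(z)=\inf\{t>0: t^{-1}z\in D\}$ be the Minkowski functional of $D$, let $\rho_D=m_D^2-1$, let $\partial\rho_D=(\partial\rho_D/\partial\zeta_1,\dots,\partial\rho_D/\partial\zeta_n)$ with $\partial/\partial\zeta_j=\frac12(\partial/\partial x_j-i\,\partial/\partial y_j)$, let $\langle a,b\rangle=\sum_{j=1}^n a_jb_j$, and put $$B_D(\zeta,z)=\langle\partial\rho_D(\zeta),\zeta-z\rangle-\rho_D(\zeta),\qquad (\zeta,z)\in\overline D\times\overline D.$$ (a) There are constants $C_1,C_2>0$ such that, for all $(\zeta,z)\in\overline D\times\overline D$, $$C_1\,E(\zeta,z)\le|B_D(\zeta,z)|\le C_2\,E(\zeta,z),$$ where $E(\zeta,z)=|\rho_D(\zeta)|+|\rho_D(z)|+|\operatorname{Im}\langle\partial\rho_D(\zeta),\zeta-z\rangle|+\|\zeta-z\|^2$.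 (b) For every $p\in(1,\infty)$ the integral operator $$|\mathcal B_D|(f)(z)=\int_D f(\zeta)\,|B_D(\zeta,z)|^{-n-1}\,dV(\zeta),\qquad z\in D,$$ where $V$ is Lebesgue measure, is a bounded operator on $L^p(D)$: for every $f\in L^p(D)$ the integral converges absolutely for every $z\in D$, $|\mathcal B_D|(f)\in L^p(D)$, and $\||\mathcal B_D|(f)\|_{L^p(D)}\le C\|f\|_{L^p(D)}$ with a constant $C$ that does not depend on $f$. -/

import Mathlib

open MeasureTheory Set Topology
open scoped NNReal ENNReal

/-- Complex Euclidean space `ℂⁿ`, with its Euclidean norm and Lebesgue measure. -/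
abbrev Cn (n : ℕ) : Type := EuclideanSpace ℂ (Fin n)

/-- `D ⊆ ℂⁿ` is a `C²`-smooth strongly convex domain: `D` is open and connected, and `D = {r < 0}` for
some real `C²` function `r` on `ℂⁿ` whose differential vanishes nowhere on the boundary of `D` and whose
real Hessian is positive definite on the real tangent space at every boundary point of `D`. -/
structure IsStronglyConvexDomain {n : ℕ} (D : Set (Cn n)) : Prop where
  isOpen : IsOpen D
  isConnected : IsConnected D
  exists_definingFunction : ∃ r : Cn n → ℝ, ContDiff ℝ 2 r ∧ D = {z | r z < 0} ∧
    ∀ z ∈ frontier D, fderiv ℝ r z ≠ 0 ∧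
      ∀ v : Cn n, v ≠ 0 → fderiv ℝ r z v = 0 → 0 < fderiv ℝ (fderiv ℝ r) z v v

/-- The complex bilinear pairing `⟨a, b⟩ = ∑ j, a j * b j` on `ℂⁿ` (no conjugation). -/
noncomputable def bilin {n : ℕ} (a b : Cn n) : ℂ := ∑ j, a j * b j

/-- The holomorphic gradient `∂f = (∂f/∂ζ₁, …, ∂f/∂ζₙ)` of a real-valued function, where
`∂/∂ζⱼ = (∂/∂xⱼ - i ∂/∂yⱼ) / 2`. -/
noncomputable def holGrad {n : ℕ} (f : Cn n → ℝ) (ζ : Cn n) : Cn n :=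
  WithLp.toLp 2 fun j =>
    ((fderiv ℝ f ζ (EuclideanSpace.single j 1) : ℂ) -
      Complex.I * (fderiv ℝ f ζ (EuclideanSpace.single j Complex.I) : ℂ)) / 2

/-- `ρ_D = m_D² - 1`, where `m_D(z) = inf {t > 0 : t⁻¹ z ∈ D}` is the Minkowski functional of `D`. -/
noncomputable def rhoD {n : ℕ} (D : Set (Cn n)) (ζ : Cn n) : ℝ := gauge D ζ ^ 2 - 1

/-- The kernel `B_D(ζ, z) = ⟨∂ρ_D(ζ), ζ - z⟩ - ρ_D(ζ)`. -/
noncomputable def kerB {n : ℕ} (D : Set (Cn n)) (ζ z : Cn n) : ℂ :=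
  bilin (holGrad (rhoD D) ζ) (ζ - z) - (rhoD D ζ : ℂ)

/-- The positive kernel `|B_D(ζ, z)|^{-n-1}`. -/
noncomputable def absKer {n : ℕ} (D : Set (Cn n)) (ζ z : Cn n) : ℝ :=
  ‖kerB D ζ z‖ ^ (-(n : ℤ) - 1)

/-- The operator `|𝓑_D|(f)(z) = ∫_D f(ζ) |B_D(ζ, z)|^{-n-1} dV(ζ)`. -/
noncomputable def absOpB {n : ℕ} (D : Set (Cn n)) (f : Cn n → ℂ) (z : Cn n) : ℂ :=
  ∫ ζ in D, f ζ * (absKer D ζ z : ℂ)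

/-! ### One-sided quadratic bounds at the boundary from the tangential Hessian. -/

section DefiningFunction

variable {E : Type*} [NormedAddCommGroup E] [NormedSpace ℝ E]

/-! Everything rests on one fact about $\rho=\rho_D$: at all pairs of points its first-order Taylor
remainder lies between $c\|z-\zeta\|^2$ and $C\|z-\zeta\|^2$
(`IsStronglyConvexDomain.exists_pinched`). Compactness and the tangential Hessian of the defining
function place $\overline D$ quadratically on one side of each boundary hyperplane. This forces
convexity, and homogeneity carries the resulting pinching of the boundary over to the squared gauge.
No second derivative of the gauge is needed.

Part (a) is then an identity: $2\operatorname{Re}B_D(\zeta,z)$ equals $|\rho(\zeta)|+|\rho(z)|$ plus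
the Taylor remainder, and $\operatorname{Im}B_D$ is the imaginary term of $E$.

For (b), $\{|B_D|\le s\}$ lies in a box of radius about $\sqrt s$ that has thickness about $s$ in
the direction $i\nu$, with $\nu$ transverse to the level sets of $\rho$. Cutting it with the layer
$|\rho|\le u$ leaves volume $O(us^n)$ (`exists_volume_kerB_le`). Summation over dyadic shells gives
$\int_D|B_D|^{-n-1}|\rho|^{-\alpha}\lesssim|\rho|^{-\alpha}$ for $0<\alpha<1$, with integration in
either variable. Schur's test with a power of $|\rho|$ as weight concludes. -/

/-- Second-order Taylor lower bound along a segment. -/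
theorem le_of_le_second_fderiv_segment {r : E → ℝ} (hr : ContDiff ℝ 2 r) {x v : E} {κ t : ℝ}
    (ht : 0 ≤ t) (h : ∀ τ ∈ Icc 0 t, κ ≤ fderiv ℝ (fderiv ℝ r) (x + τ • v) v v) :
    r x + t * fderiv ℝ r x v + κ * t ^ 2 / 2 ≤ r (x + t • v) := by
  have hr1 : Differentiable ℝ r := hr.differentiable (by norm_num)
  have hr2 : Differentiable ℝ (fderiv ℝ r) :=
    (hr.fderiv_right (m := 1) (by norm_num)).differentiable (by norm_num)
  have hl : ∀ τ : ℝ, HasDerivAt (fun τ : ℝ => x + τ • v) v τ := fun τ => by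
    simpa using ((hasDerivAt_id τ).smul_const v).const_add x
  have hg : ∀ τ : ℝ, HasDerivAt (fun τ : ℝ => r (x + τ • v)) (fderiv ℝ r (x + τ • v) v) τ :=
    fun τ => (hr1 _).hasFDerivAt.comp_hasDerivAt τ (hl τ)
  have hg' : ∀ τ : ℝ, HasDerivAt (fun τ : ℝ => fderiv ℝ r (x + τ • v) v)
      (fderiv ℝ (fderiv ℝ r) (x + τ • v) v v) τ := fun τ => by
    have := (hr2 (x + τ • v)).hasFDerivAt.comp_hasDerivAt τ (hl τ)
    exact this.clm_apply (hasDerivAt_const τ v) |>.congr_deriv (by simp)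
  have first : ∀ τ ∈ Icc 0 t, fderiv ℝ r x v + κ * τ ≤ fderiv ℝ r (x + τ • v) v := by
    refine image_le_of_deriv_right_le_deriv_boundary (f' := fun _ => κ)
      (B' := fun τ => fderiv ℝ (fderiv ℝ r) (x + τ • v) v v) (by fun_prop) ?_ (by simp)
      (fun τ _ => (hg' τ).continuousAt.continuousWithinAt) (fun τ _ => (hg' τ).hasDerivWithinAt)
      (fun τ hτ => h τ ⟨hτ.1, hτ.2.le⟩)
    intro τ _
    simpa using (((hasDerivAt_id τ).const_mul κ).const_add (fderiv ℝ r x v)).hasDerivWithinAt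
  have second : ∀ τ ∈ Icc 0 t, r x + τ * fderiv ℝ r x v + κ * τ ^ 2 / 2 ≤ r (x + τ • v) := by
    refine image_le_of_deriv_right_le_deriv_boundary (f' := fun τ => fderiv ℝ r x v + κ * τ)
      (B' := fun τ => fderiv ℝ r (x + τ • v) v) (by fun_prop) ?_ (by simp)
      (fun τ _ => (hg τ).continuousAt.continuousWithinAt) (fun τ _ => (hg τ).hasDerivWithinAt)
      (fun τ hτ => first τ ⟨hτ.1, hτ.2.le⟩)
    intro τ _
    have h1 := ((hasDerivAt_id τ).mul_const (fderiv ℝ r x v)).const_add (r x)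
    have h2 := (((hasDerivAt_id τ).pow 2).const_mul κ).div_const 2
    refine HasDerivAt.hasDerivWithinAt ((h1.add h2).congr_deriv ?_)
    simp; ring
  exact second t ⟨ht, le_rfl⟩

variable [FiniteDimensional ℝ E]

/-- Near a compact set of zeros at which the Hessian is positive on the tangent space, the sublevel
set `{r ≤ 0}` lies quadratically on one side of the tangent hyperplane. -/
theorem exists_local_tangent_bound {r : E → ℝ} (hr : ContDiff ℝ 2 r) {K : Set E} (hK : IsCompact K)
    (h0 : ∀ ζ ∈ K, r ζ = 0)
    (hpos : ∀ ζ ∈ K, ∀ v : E, v ≠ 0 → fderiv ℝ r ζ v = 0 → 0 < fderiv ℝ (fderiv ℝ r) ζ v v) :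
    ∃ ε > 0, ∃ c > 0, ∀ ζ ∈ K, ∀ w, r w ≤ 0 → ‖w - ζ‖ < ε →
      c * ‖w - ζ‖ ^ 2 ≤ fderiv ℝ r ζ (ζ - w) := by
  have hc1 : Continuous (fderiv ℝ r) := hr.continuous_fderiv (by norm_num)
  have hc2 : Continuous (fderiv ℝ (fderiv ℝ r)) :=
    (hr.fderiv_right (m := 1) (by norm_num)).continuous_fderiv (by norm_num)
  -- The distance $t$ (`x.1`) and the constant $c$ (`x.2`) tend to zero together, so a single
  -- compactness argument over base points and unit directions yields both.
  have key : ∀ᶠ x : ℝ × ℝ in 𝓝 (0, 0), ∀ y ∈ K ×ˢ Metric.sphere (0 : E) 1,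
      0 < x.1 → 0 < x.2 → y.1 ∈ K → r (y.1 + x.1 • y.2) ≤ 0 → x.2 * x.1 ≤ -fderiv ℝ r y.1 y.2 := by
    refine IsCompact.eventually_forall_of_forall_eventually (hK.prod (isCompact_sphere 0 1))
      (P := fun (x : ℝ × ℝ) (y : E × E) => 0 < x.1 → 0 < x.2 → y.1 ∈ K →
        r (y.1 + x.1 • y.2) ≤ 0 →
        x.2 * x.1 ≤ -fderiv ℝ r y.1 y.2) ?_
    rintro ⟨ζ₀, v₀⟩ ⟨hζ₀, hv₀⟩
    have hv₀' : v₀ ≠ 0 := by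
      rintro rfl; simp at hv₀
    -- a lower bound for the Hessian near the base point gives a Taylor bound
    have taylor : ∀ κ < fderiv ℝ (fderiv ℝ r) ζ₀ v₀ v₀, ∀ᶠ z : (ℝ × ℝ) × (E × E) in
        𝓝 ((0, 0), (ζ₀, v₀)), 0 < z.1.1 → z.2.1 ∈ K → r (z.2.1 + z.1.1 • z.2.2) ≤ 0 →
          κ * z.1.1 / 2 ≤ -fderiv ℝ r z.2.1 z.2.2 := by
      intro κ hκ
      have hcont : Continuous fun z : (ℝ × ℝ) × (E × E) =>
          fderiv ℝ (fderiv ℝ r) (z.2.1 + z.1.1 • z.2.2) z.2.2 z.2.2 :=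
        ((hc2.comp (by fun_prop)).clm_apply (by fun_prop)).clm_apply (by fun_prop)
      have := (hcont.tendsto' ((0, 0), (ζ₀, v₀)) (fderiv ℝ (fderiv ℝ r) ζ₀ v₀ v₀)
        (by simp)).eventually_const_lt hκ
      obtain ⟨η, hη, hball⟩ := Metric.eventually_nhds_iff.1 this
      refine Metric.eventually_nhds_iff.2 ⟨η, hη, ?_⟩
      rintro ⟨⟨t, c⟩, ⟨ζ, v⟩⟩ hz ht hζ hneg
      simp only at ht hζ hneg ⊢
      simp only [Prod.dist_eq, max_lt_iff] at hz
      have := le_of_le_second_fderiv_segment hr (x := ζ) (v := v) (κ := κ) ht.le (fun τ hτ => by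
        refine (hball (y := ((τ, c), (ζ, v))) ?_).le
        simp only [Prod.dist_eq, max_lt_iff]
        refine ⟨⟨lt_of_le_of_lt ?_ hz.1.1, hz.1.2⟩, hz.2⟩
        simp only [Real.dist_eq, sub_zero, abs_of_nonneg hτ.1, abs_of_pos ht, hτ.2])
      rw [h0 ζ hζ] at this
      have h3 : t * (fderiv ℝ r ζ v + κ * t / 2) ≤ 0 := by nlinarith
      have := nonpos_of_mul_nonpos_right h3 ht
      linarith
    have hcont : Continuous fun z : (ℝ × ℝ) × (E × E) => fderiv ℝ r z.2.1 z.2.2 :=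
      (hc1.comp (by fun_prop)).clm_apply (by fun_prop)
    rcases lt_trichotomy (fderiv ℝ r ζ₀ v₀) 0 with ha | ha | ha
    · have hc : Continuous fun z : (ℝ × ℝ) × (E × E) =>
        fderiv ℝ r z.2.1 z.2.2 + z.1.2 * z.1.1 := by fun_prop
      filter_upwards [(hc.tendsto' ((0, 0), (ζ₀, v₀)) (fderiv ℝ r ζ₀ v₀) (by simp)).eventually_lt_const ha]
        with z hz _ _ _ _
      linarith
    · have hp := hpos ζ₀ hζ₀ v₀ hv₀' ha
      have hc : Continuous fun z : (ℝ × ℝ) × (E × E) => z.1.2 := by fun_prop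
      filter_upwards [taylor _ (half_lt_self hp), (hc.tendsto' ((0, 0), (ζ₀, v₀)) 0
        (by simp)).eventually_lt_const (show 0 < fderiv ℝ (fderiv ℝ r) ζ₀ v₀ v₀ / 4 by linarith)] with z hz hz' h1 h2 h3 h4
      have := hz h1 h3 h4
      nlinarith
    -- An outward direction: $r\le0$ is impossible for small $t$, so the claim is vacuous. Any
    -- $\kappa$ below the Hessian value serves here.
    · have hc : Continuous fun z : (ℝ × ℝ) × (E × E) => fderiv ℝ r z.2.1 z.2.2 +
        (fderiv ℝ (fderiv ℝ r) ζ₀ v₀ v₀ - 1) * z.1.1 / 2 := by fun_prop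
      filter_upwards [taylor _ (sub_one_lt _), (hc.tendsto' ((0, 0), (ζ₀, v₀))
        (fderiv ℝ r ζ₀ v₀) (by simp)).eventually_const_lt ha] with z hz hz' h1 h2 h3 h4
      have := hz h1 h3 h4
      linarith
  obtain ⟨η, hη, hball⟩ := Metric.eventually_nhds_iff.1 key
  refine ⟨η, hη, η / 2, by positivity, fun ζ hζ w hw hwζ => ?_⟩
  rcases eq_or_ne w ζ with rfl | hne
  · simp
  have hpos' : 0 < ‖w - ζ‖ := norm_pos_iff.2 (sub_ne_zero.2 hne)
  have := hball (y := (‖w - ζ‖, η / 2)) (by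
      simp only [Prod.dist_eq, Real.dist_eq, sub_zero, abs_norm, max_lt_iff]
      exact ⟨hwζ, by rw [abs_of_pos (by positivity)]; linarith⟩) (ζ, ‖w - ζ‖⁻¹ • (w - ζ))
    ⟨hζ, by simp [norm_smul, hpos'.ne']⟩ hpos' (by positivity) hζ
    (by simpa [smul_smul, hpos'.ne'] using hw)
  simp only [map_smul, smul_eq_mul] at this
  have h2 : fderiv ℝ r ζ (ζ - w) = -fderiv ℝ r ζ (w - ζ) := by rw [← map_neg, neg_sub]
  rw [h2]
  have h3 := mul_le_mul_of_nonneg_left this hpos'.le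
  have h4 : ‖w - ζ‖ * -(‖w - ζ‖⁻¹ * fderiv ℝ r ζ (w - ζ)) = -fderiv ℝ r ζ (w - ζ) := by
    field_simp
  rw [h4] at h3
  linarith

end DefiningFunction

/-! ### From local to global convexity, and Taylor remainders. -/

section LocallyConvex

variable {E : Type*} [NormedAddCommGroup E] [NormedSpace ℝ E]

/-- A connected open set whose boundary lies locally strictly on one side of hyperplanes is convex. -/
theorem convex_of_local_tangent_bound {D : Set E} (hD : IsOpen D) (hconn : IsPreconnected D)
    {L : E → E →L[ℝ] ℝ} {ε c : ℝ} (hε : 0 < ε) (hc : 0 < c)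
    (h : ∀ ζ ∈ frontier D, ∀ w ∈ closure D, ‖w - ζ‖ < ε → c * ‖w - ζ‖ ^ 2 ≤ L ζ (ζ - w)) :
    Convex ℝ D := by
  rw [convex_iff_segment_subset]
  intro x hx
  -- The set of points visible from $x$ is open by compactness of the segment. It is also relatively
  -- closed in $D$: a limiting segment can leave $D$ only by touching the boundary from inside.
  suffices hU : D ⊆ {y | ∀ t ∈ Icc (0 : ℝ) 1, x + t • (y - x) ∈ D} by
    intro y hy
    rw [segment_eq_image']
    rintro _ ⟨t, ht, rfl⟩
    exact hU hy t ht
  refine hconn.subset_of_closure_inter_subset ?_ ⟨x, hx, fun t _ => by simpa using hx⟩ ?_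
  · rw [isOpen_iff_mem_nhds]
    intro y hy
    refine IsCompact.eventually_forall_of_forall_eventually (isCompact_Icc (a := (0 : ℝ)) (b := 1))
      (P := fun y t => x + t • (y - x) ∈ D) fun t ht => ?_
    have hcont : Continuous fun z : E × ℝ => x + z.2 • (z.1 - x) := by fun_prop
    exact hcont.continuousAt.eventually (hD.mem_nhds (hy t ht))
  · rintro y ⟨hy, hyD⟩
    have hcl : ∀ t ∈ Icc (0 : ℝ) 1, x + t • (y - x) ∈ closure D := by
      intro t ht
      have hcont : Continuous fun y : E => x + t • (y - x) := by fun_prop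
      exact map_mem_closure (f := fun y => x + t • (y - x)) hcont hy fun z hz => hz t ht
    intro t ht
    by_contra hp
    have hfr : x + t • (y - x) ∈ frontier D := by
      rw [hD.frontier_eq]; exact ⟨hcl t ht, hp⟩
    have ht0 : 0 < t := ht.1.lt_of_ne (by rintro rfl; exact hp (by simpa using hx))
    have ht1 : t < 1 := ht.2.lt_of_ne (by rintro rfl; exact hp (by simpa using hyD))
    have hne : 0 < ‖y - x‖ := by
      rw [norm_pos_iff, sub_ne_zero]; rintro rfl; exact hp (by simpa using hx)
    obtain ⟨s, hs0, hs⟩ := exists_between (show 0 < min (min t (1 - t)) (ε / ‖y - x‖) from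
      lt_min (lt_min ht0 (by linarith)) (by positivity))
    simp only [lt_min_iff] at hs
    rw [lt_div_iff₀ hne] at hs
    -- At such a contact point the segment continues in $\overline D$ both ways, so the supporting
    -- functional would be strictly positive on a vector and on its negative.
    have main : ∀ σ : ℝ, |σ| = s → 0 < -σ * L (x + t • (y - x)) (y - x) := by
      intro σ hσ
      have hmem : x + t • (y - x) + σ • (y - x) ∈ closure D := by
        rw [add_assoc, ← add_smul]
        refine hcl _ ⟨?_, ?_⟩ <;> [have := neg_abs_le σ; have := le_abs_self σ] <;> linarith
      have := h _ hfr _ hmem (by simpa [norm_smul, hσ] using hs.2)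
      have h2 : x + t • (y - x) - (x + t • (y - x) + σ • (y - x)) = (-σ) • (y - x) := by
        rw [sub_add_cancel_left, neg_smul]
      rw [h2, map_smul, smul_eq_mul] at this
      refine lt_of_lt_of_le ?_ this
      have : 0 < |σ| := hσ ▸ hs0
      simp only [add_sub_cancel_left, norm_smul, Real.norm_eq_abs]
      positivity
    have h1 := main s (abs_of_pos hs0)
    have h2 := main (-s) (by rw [abs_neg, abs_of_pos hs0])
    linarith

/-- For a bounded convex set the local quadratic bound is global. -/
theorem exists_global_tangent_bound {D : Set E} (hconv : Convex ℝ D) (hb : Bornology.IsBounded D)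
    {L : E → E →L[ℝ] ℝ} {ε c : ℝ} (hε : 0 < ε) (hc : 0 < c)
    (h : ∀ ζ ∈ frontier D, ∀ w ∈ closure D, ‖w - ζ‖ < ε → c * ‖w - ζ‖ ^ 2 ≤ L ζ (ζ - w)) :
    ∃ c' > 0, ∀ ζ ∈ frontier D, ∀ w ∈ closure D, c' * ‖w - ζ‖ ^ 2 ≤ L ζ (ζ - w) := by
  obtain ⟨M, hM0, hM⟩ : ∃ M > 0, ∀ ζ ∈ closure D, ∀ w ∈ closure D, ‖w - ζ‖ ≤ M := by
    obtain ⟨R, hR⟩ := hb.closure.exists_norm_le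
    refine ⟨2 * max R 1, by positivity, fun ζ hζ w hw => (norm_sub_le _ _).trans ?_⟩
    linarith [hR _ hζ, hR _ hw, le_max_left R 1]
  -- Contracting $w$ towards $\zeta$ by $t$ reaches the local range. The left side scales by $t^2$
  -- and the right by $t$, which leaves the constant $ct$.
  obtain ⟨t, ht0, ht⟩ := exists_between (show 0 < min 1 (ε / M) from lt_min one_pos (by positivity))
  rw [lt_min_iff, lt_div_iff₀ hM0] at ht
  refine ⟨c * t, by positivity, fun ζ hζ w hw => ?_⟩
  have hζ' := frontier_subset_closure hζ
  have hmem : ζ + t • (w - ζ) ∈ closure D :=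
    hconv.closure.add_smul_sub_mem hζ' hw ⟨ht0.le, ht.1.le⟩
  have h1 := h ζ hζ _ hmem (by
    rw [add_sub_cancel_left, norm_smul, Real.norm_eq_abs, abs_of_pos ht0]
    exact lt_of_le_of_lt (mul_le_mul_of_nonneg_left (hM _ hζ' _ hw) ht0.le) ht.2)
  have h2 : ζ - (ζ + t • (w - ζ)) = t • (ζ - w) := by
    rw [sub_add_cancel_left, ← smul_neg, neg_sub]
  rw [h2, map_smul, add_sub_cancel_left, norm_smul, Real.norm_eq_abs, abs_of_pos ht0,
    smul_eq_mul] at h1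
  refine le_of_mul_le_mul_left ?_ ht0
  linarith

/-- Uniform first-order Taylor estimate with quadratic remainder on a compact set. -/
theorem exists_taylor_bound [FiniteDimensional ℝ E] {r : E → ℝ} (hr : ContDiff ℝ 2 r) {K : Set E}
    (hK : Bornology.IsBounded K) :
    ∃ C > 0, ∀ ζ ∈ K, ∀ w ∈ K, |r w - r ζ - fderiv ℝ r ζ (w - ζ)| ≤ C * ‖w - ζ‖ ^ 2 := by
  obtain ⟨R, hR⟩ := hK.subset_closedBall (0 : E)
  have hr1 : Differentiable ℝ r := hr.differentiable (by norm_num)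
  have hr2 : Differentiable ℝ (fderiv ℝ r) :=
    (hr.fderiv_right (m := 1) (by norm_num)).differentiable (by norm_num)
  have hc2 : Continuous (fderiv ℝ (fderiv ℝ r)) :=
    (hr.fderiv_right (m := 1) (by norm_num)).continuous_fderiv (by norm_num)
  obtain ⟨C, hC⟩ := (isCompact_closedBall (0 : E) R).exists_bound_of_continuousOn
    (f := fderiv ℝ (fderiv ℝ r)) hc2.continuousOn
  refine ⟨max C 1, by positivity, fun ζ hζ w hw => ?_⟩
  have hball : segment ℝ ζ w ⊆ Metric.closedBall 0 R :=
    (convex_closedBall 0 R).segment_subset (hR hζ) (hR hw)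
  have hd : ∀ x ∈ segment ℝ ζ w, ‖fderiv ℝ r x - fderiv ℝ r ζ‖ ≤ max C 1 * ‖w - ζ‖ := by
    intro x hx
    refine ((convex_closedBall (0 : E) R).norm_image_sub_le_of_norm_fderiv_le (fun x _ => hr2 x)
      (fun x hx => (hC x hx).trans (le_max_left C 1)) (hR hζ) (hball hx)).trans ?_
    refine mul_le_mul_of_nonneg_left ?_ (by positivity)
    simpa [norm_sub_rev] using norm_sub_le_of_mem_segment hx
  have := (convex_segment ζ w).norm_image_sub_le_of_norm_fderiv_le' (fun x _ => hr1 x) hd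
    (left_mem_segment ℝ ζ w) (right_mem_segment ℝ ζ w)
  rw [Real.norm_eq_abs] at this
  linarith [this]

end LocallyConvex

/-! ### Normalised supporting functionals. -/

section SupportFunctional

variable {E : Type*} [NormedAddCommGroup E] [NormedSpace ℝ E] [FiniteDimensional ℝ E]

/-- A bounded connected open set containing `0`, with a `C²` defining function whose Hessian is positive
on boundary tangent spaces, is convex and is pinched quadratically between its boundary hyperplanes. -/
theorem convex_and_exists_support {D : Set E} (hD : IsOpen D) (hconn : IsPreconnected D)
    (hb : Bornology.IsBounded D) (h0 : (0 : E) ∈ D) {r : E → ℝ} (hr : ContDiff ℝ 2 r)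
    (hDr : D = {z | r z < 0})
    (hpos : ∀ z ∈ frontier D, ∀ v : E, v ≠ 0 → fderiv ℝ r z v = 0 →
      0 < fderiv ℝ (fderiv ℝ r) z v v) :
    Convex ℝ D ∧ ∃ c > 0, ∃ C > 0, ∀ ζ ∈ frontier D, ∃ l : E →L[ℝ] ℝ, l ζ = 1 ∧
      ∀ w ∈ frontier D, c * ‖w - ζ‖ ^ 2 ≤ 1 - l w ∧ 1 - l w ≤ C * ‖w - ζ‖ ^ 2 := by
  have hr1 : Differentiable ℝ r := hr.differentiable (by norm_num)
  have hneg : ∀ w ∈ closure D, r w ≤ 0 := by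
    intro w hw
    exact closure_minimal (fun z hz => by rw [hDr] at hz; exact (show r z < 0 from hz).le)
      (isClosed_le hr1.continuous continuous_const) hw
  have hzero : ∀ ζ ∈ frontier D, r ζ = 0 := by
    intro ζ hζ
    refine le_antisymm (hneg ζ (frontier_subset_closure hζ)) ?_
    rw [hD.frontier_eq] at hζ
    by_contra! h
    exact hζ.2 (by rw [hDr]; exact h)
  have hK : IsCompact (frontier D) :=
    Metric.isCompact_of_isClosed_isBounded isClosed_frontier
      (hb.closure.subset frontier_subset_closure)
  obtain ⟨ε, hε, c, hc, hloc⟩ := exists_local_tangent_bound hr hK hzero hpos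
  have hloc' : ∀ ζ ∈ frontier D, ∀ w ∈ closure D, ‖w - ζ‖ < ε →
      c * ‖w - ζ‖ ^ 2 ≤ fderiv ℝ r ζ (ζ - w) := fun ζ hζ w hw => hloc ζ hζ w (hneg w hw)
  have hconv := convex_of_local_tangent_bound hD hconn hε hc hloc'
  refine ⟨hconv, ?_⟩
  obtain ⟨c', hc', hglob⟩ := exists_global_tangent_bound hconv hb hε hc hloc'
  obtain ⟨C, hC, htay⟩ := exists_taylor_bound hr hK.isBounded
  obtain ⟨M, hM⟩ := hK.exists_bound_of_continuousOn (f := fun ζ => fderiv ℝ r ζ ζ)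
    (((hr.continuous_fderiv (by norm_num)).clm_apply continuous_id).continuousOn)
  obtain ⟨δ, hδ, hball⟩ := Metric.isOpen_iff.1 hD 0 h0
  -- The global bound tested at the interior point $w=0$ keeps $dr_\zeta(\zeta)$ away from zero, so
  -- $dr_\zeta$ can be normalised to take the value $1$ at $\zeta$.
  have hlow : ∀ ζ ∈ frontier D, c' * δ ^ 2 ≤ fderiv ℝ r ζ ζ := by
    intro ζ hζ
    have h1 := hglob ζ hζ 0 (subset_closure h0)
    have h2 : δ ≤ ‖ζ‖ := by
      by_contra! h
      rw [hD.frontier_eq] at hζ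
      exact hζ.2 (hball (by simpa using h))
    rw [zero_sub, norm_neg, sub_zero] at h1
    refine le_trans ?_ h1
    gcongr
  have hκ : 0 < c' * δ ^ 2 := by positivity
  refine ⟨c' / max M 1, by positivity, C / (c' * δ ^ 2), by positivity, fun ζ hζ =>
    ⟨(fderiv ℝ r ζ ζ)⁻¹ • fderiv ℝ r ζ, ?_, fun w hw => ?_⟩⟩
  · have := (hκ.trans_le (hlow ζ hζ)).ne'
    simp [this]
  · have hp := hκ.trans_le (hlow ζ hζ)
    have h1 : 1 - ((fderiv ℝ r ζ ζ)⁻¹ • fderiv ℝ r ζ) w =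
        fderiv ℝ r ζ (ζ - w) / fderiv ℝ r ζ ζ := by
      simp [map_sub]; field_simp
    have hg := hglob ζ hζ w (frontier_subset_closure hw)
    rw [h1]
    constructor
    · rw [div_mul_eq_mul_div]
      refine div_le_div₀ (le_trans (by positivity) hg) hg hp ?_
      exact (le_abs_self _).trans ((hM ζ hζ).trans (le_max_left _ _))
    · have ht := htay ζ hζ w hw
      rw [hzero ζ hζ, hzero w hw, sub_zero, zero_sub, ← map_neg, neg_sub] at ht
      rw [div_mul_eq_mul_div]
      exact div_le_div₀ (by positivity) ((le_abs_self _).trans ht) hκ (hlow ζ hζ)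

end SupportFunctional

/-! ### Regularity consequences of quadratic pinching. -/

section QuadraticPinching

variable {E : Type*} [NormedAddCommGroup E] [NormedSpace ℝ E]

theorem hasFDerivAt_of_abs_sub_le_sq {f : E → ℝ} {L : E →L[ℝ] ℝ} {x : E} {C : ℝ}
    (h : ∀ z, |f z - f x - L (z - x)| ≤ C * ‖z - x‖ ^ 2) : HasFDerivAt f L x := by
  have h0 : HasFDerivAt (fun z => f z - f x - L (z - x)) (0 : E →L[ℝ] ℝ) x := by
    refine Asymptotics.IsBigO.hasFDerivAt (n := 2) ?_ (by norm_num)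
    refine Asymptotics.IsBigO.of_bound C (Filter.Eventually.of_forall fun z => ?_)
    simpa using h z
  have h1 : HasFDerivAt (fun z => f x + L (z - x)) L x :=
    ((L.hasFDerivAt.comp x ((hasFDerivAt_id x).sub_const x)).const_add (f x)).congr_fderiv (by ext; simp)
  exact ((h0.add h1).congr_fderiv (zero_add L)).congr_of_eventuallyEq
    (Filter.Eventually.of_forall fun z => by simp)

/-- A convex function with quadratically bounded Taylor remainder has Lipschitz derivative. -/
theorem abs_fderiv_sub_le_of_quadratic_pinching {f : E → ℝ} {C : ℝ}
    (h : ∀ x z, 0 ≤ f z - f x - fderiv ℝ f x (z - x) ∧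
      f z - f x - fderiv ℝ f x (z - x) ≤ C * ‖z - x‖ ^ 2) (x z v : E) :
    |fderiv ℝ f x v - fderiv ℝ f z v| ≤ 4 * C * ‖x - z‖ * ‖v‖ := by
  -- The value at $z+v$ lies above the tangent plane at $z$ and at most $C\|z+v-x\|^2$ above the one
  -- at $x$. Since $\|v\|=\|x-z\|$, this error is at most $4C\|x-z\|^2$.
  have key : ∀ v, ‖v‖ = ‖x - z‖ → fderiv ℝ f z v - fderiv ℝ f x v ≤ 4 * C * ‖x - z‖ ^ 2 := by
    intro v hv
    have h1 := (h x (z + v)).2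
    have h2 := (h z (z + v)).1
    have h3 := (h x z).1
    have h4 : fderiv ℝ f x (z + v - x) = fderiv ℝ f x (z - x) + fderiv ℝ f x v := by
      rw [← map_add]; congr 1; abel
    rw [add_sub_cancel_left] at h2
    have hC : 0 ≤ C * ‖x - z‖ ^ 2 := by
      have := h3.trans (h x z).2
      rwa [norm_sub_rev] at this
    have h5 : ‖z + v - x‖ ≤ 2 * ‖x - z‖ := by
      have : z + v - x = (z - x) + v := by abel
      rw [this]
      refine (norm_add_le _ _).trans ?_
      rw [hv, norm_sub_rev z x]; linarith
    rcases (norm_nonneg (x - z)).eq_or_lt with h0 | h0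
    · have : v = 0 := by rw [← norm_eq_zero, hv, ← h0]
      simp [this, ← h0]
    · have hC' : 0 ≤ C := nonneg_of_mul_nonneg_left hC (by positivity)
      have h6 : C * ‖z + v - x‖ ^ 2 ≤ C * (2 * ‖x - z‖) ^ 2 := by gcongr
      nlinarith
  rcases eq_or_ne v 0 with rfl | hv
  · simp
  rcases eq_or_ne x z with rfl | hxz
  · simp
  have hv' := norm_pos_iff.2 hv
  have hd : 0 < ‖x - z‖ := norm_pos_iff.2 (sub_ne_zero.2 hxz)
  have main : ∀ s : ℝ, |s| = ‖x - z‖ / ‖v‖ →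
      s * (fderiv ℝ f z v - fderiv ℝ f x v) ≤ 4 * C * ‖x - z‖ ^ 2 := by
    intro s hs
    have := key (s • v) (by rw [norm_smul, Real.norm_eq_abs, hs, div_mul_cancel₀ _ hv'.ne'])
    simpa [mul_sub] using this
  have hq : 0 < ‖x - z‖ / ‖v‖ := by positivity
  have h1 := main _ (abs_of_pos hq)
  have h2 := main (-(‖x - z‖ / ‖v‖)) (by rw [abs_neg, abs_of_pos hq])
  have h3 : ‖x - z‖ / ‖v‖ * |fderiv ℝ f x v - fderiv ℝ f z v| ≤ 4 * C * ‖x - z‖ ^ 2 := by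
    rcases abs_cases (fderiv ℝ f x v - fderiv ℝ f z v) with ⟨h, _⟩ | ⟨h, _⟩ <;> rw [h] <;> linarith
  rw [div_mul_eq_mul_div, div_le_iff₀ hv'] at h3
  refine le_of_mul_le_mul_left ?_ hd
  linarith

end QuadraticPinching

/-! ### Pinching of the squared Minkowski functional. -/

section Gauge

variable {E : Type*} [NormedAddCommGroup E] [NormedSpace ℝ E]

/-- Quadratic pinching between boundary hyperplanes passes to the squared gauge at boundary points. -/
theorem exists_sq_gauge_pinching_frontier {D : Set E} (hD : IsOpen D) (hconv : Convex ℝ D)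
    (h0 : (0 : E) ∈ D) {a b c C : ℝ} (ha : 0 < a) (hb : 0 < b) (hc : 0 < c) (hC : 0 < C)
    (hlow : ∀ z, a * ‖z‖ ≤ gauge D z) (hlip : ∀ z w, |gauge D z - gauge D w| ≤ b * ‖z - w‖) :
    ∃ c' > 0, ∃ C' > 0, ∀ ζ ∈ frontier D, ∀ l : E →L[ℝ] ℝ, l ζ = 1 →
      (∀ w ∈ frontier D, c * ‖w - ζ‖ ^ 2 ≤ 1 - l w ∧ 1 - l w ≤ C * ‖w - ζ‖ ^ 2) →
      ∀ z, c' * ‖z - ζ‖ ^ 2 ≤ gauge D z ^ 2 - 1 - 2 * l (z - ζ) ∧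
        gauge D z ^ 2 - 1 - 2 * l (z - ζ) ≤ C' * ‖z - ζ‖ ^ 2 := by
  have hnhds : D ∈ 𝓝 0 := hD.mem_nhds h0
  have hfr : ∀ w, gauge D w = 1 ↔ w ∈ frontier D := fun w =>
    gauge_eq_one_iff_mem_frontier hconv hnhds
  obtain ⟨R, hR, haR⟩ : ∃ R > 0, a * R = 1 := ⟨a⁻¹, by positivity, mul_inv_cancel₀ ha.ne'⟩
  have hnorm : ∀ w ∈ frontier D, ‖w‖ ≤ R := fun w hw => by
    have := hlow w
    rw [(hfr w).2 hw, ← haR] at this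
    exact le_of_mul_le_mul_left this ha
  -- In the lower constant, $1/(16R^2)$ serves $m<1/2$ and the other two serve $m\ge1/2$. In the
  -- upper one, $b^2$ bounds $(m-1)^2$, the second term serves $m\ge1/2$, the third $m<1/2$.
  refine ⟨min (min (1 / (2 * R ^ 2)) (c / 2)) (1 / (16 * R ^ 2)), by positivity,
    b ^ 2 + 4 * C * (1 + b * R) ^ 2 + 16 * C * R ^ 2 * b ^ 2, by positivity, ?_⟩
  set c' := min (min (1 / (2 * R ^ 2)) (c / 2)) (1 / (16 * R ^ 2)) with hc'
  have hc'0 : 0 < c' := by positivity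
  have hc1 : c' * (2 * R ^ 2) ≤ 1 := by
    have : c' ≤ 1 / (2 * R ^ 2) := (min_le_left _ _).trans (min_le_left _ _)
    rwa [le_div_iff₀ (by positivity)] at this
  have hc2 : c' ≤ c / 2 := (min_le_left _ _).trans (min_le_right _ _)
  have hc3 : c' * (16 * R ^ 2) ≤ 1 := by
    have : c' ≤ 1 / (16 * R ^ 2) := min_le_right _ _
    rwa [le_div_iff₀ (by positivity)] at this
  clear_value c'
  intro ζ hζ l hl hw z
  have hζR := hnorm ζ hζ
  set m := gauge D z with hm
  have hm0 : 0 ≤ m := gauge_nonneg z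
  have hlz : l (z - ζ) = l z - 1 := by rw [map_sub, hl]
  -- The radial part is $(m-1)^2$. With $z=mw$ and $w$ on the boundary, $m-l(z)=m(1-l(w))$ is
  -- comparable to $m\|w-\zeta\|^2$.
  have hQ : m ^ 2 - 1 - 2 * l (z - ζ) = (m - 1) ^ 2 + 2 * (m - l z) := by rw [hlz]; ring
  rw [hQ]
  obtain ⟨w, hwR, hzw, hX1, hX2⟩ : ∃ w, ‖w‖ ≤ R ∧ z = m • w ∧ c * (m * ‖w - ζ‖ ^ 2) ≤ m - l z ∧
      m - l z ≤ C * (m * ‖w - ζ‖ ^ 2) := by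
    rcases eq_or_ne z 0 with rfl | hz
    -- The origin has no radial projection; $w=0$ is harmless because every term carries the factor
    -- $m=0$.
    · exact ⟨0, by simpa using hR.le, by simp, by simp [hm], by simp [hm]⟩
    · have hmpos : 0 < m := lt_of_lt_of_le (mul_pos ha (norm_pos_iff.2 hz)) (hlow z)
      have hz' : z = m • (m⁻¹ • z) := by rw [smul_smul, mul_inv_cancel₀ hmpos.ne', one_smul]
      have hwf : m⁻¹ • z ∈ frontier D := by
        rw [← hfr, gauge_smul_of_nonneg (by positivity), smul_eq_mul, inv_mul_cancel₀ hmpos.ne']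
      have hl' : m - l z = m * (1 - l (m⁻¹ • z)) := by
        rw [map_smul, smul_eq_mul]; field_simp
      refine ⟨m⁻¹ • z, hnorm _ hwf, hz', ?_, ?_⟩
      · rw [hl']; have := mul_le_mul_of_nonneg_left (hw _ hwf).1 hm0; linarith
      · rw [hl']; have := mul_le_mul_of_nonneg_left (hw _ hwf).2 hm0; linarith
  have hlip' : |m - 1| ≤ b * ‖z - ζ‖ := by
    have := hlip z ζ
    rwa [(hfr ζ).2 hζ] at this
  have hsq : (m - 1) ^ 2 ≤ b ^ 2 * ‖z - ζ‖ ^ 2 := by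
    rw [← sq_abs, ← mul_pow]; gcongr
  have hwζ : ‖w - ζ‖ ≤ 2 * R := (norm_sub_le _ _).trans (by linarith)
  have hzζ : ‖z - ζ‖ ≤ |m - 1| * R + ‖w - ζ‖ := by
    have : z - ζ = (m - 1) • w + (w - ζ) := by rw [sub_smul, ← hzw, one_smul]; abel
    rw [this]
    refine (norm_add_le _ _).trans ?_
    rw [norm_smul, Real.norm_eq_abs]
    gcongr
  have hbR : 0 < 1 + b * R := by positivity
  clear_value m
  -- For $m<1/2$ the term $(m-1)^2\ge1/4$ dominates, all distances being bounded. Otherwise polar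
  -- and Euclidean distances are comparable.
  rcases lt_or_ge m (1 / 2) with hm2 | hm2
  · constructor
    · have h1 : ‖z - ζ‖ ≤ 2 * R := by
        refine (norm_sub_le _ _).trans ?_
        rw [hzw, norm_smul, Real.norm_eq_abs, abs_of_nonneg hm0]
        nlinarith [norm_nonneg w]
      have h2 : ‖z - ζ‖ ^ 2 ≤ (2 * R) ^ 2 := by gcongr
      have h3 : 0 ≤ m - l z := le_trans (by positivity) hX1
      nlinarith
    · have h1 : ‖w - ζ‖ ^ 2 ≤ (2 * R) ^ 2 := by gcongr
      have h2 : m * ‖w - ζ‖ ^ 2 ≤ 1 / 2 * (2 * R) ^ 2 := by gcongr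
      have h3 : C * (m * ‖w - ζ‖ ^ 2) ≤ C * (1 / 2 * (2 * R) ^ 2) := by gcongr
      have h4 : 1 / 4 ≤ b ^ 2 * ‖z - ζ‖ ^ 2 := by nlinarith
      have h5 : C * R ^ 2 * (1 / 4) ≤ C * R ^ 2 * (b ^ 2 * ‖z - ζ‖ ^ 2) := by gcongr
      have h6 : 0 ≤ 4 * C * (1 + b * R) ^ 2 * ‖z - ζ‖ ^ 2 := by positivity
      linarith
  · constructor
    · have h1 : ‖z - ζ‖ ^ 2 ≤ (|m - 1| * R + ‖w - ζ‖) ^ 2 := by gcongr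
      have h2 : ‖z - ζ‖ ^ 2 ≤ 2 * R ^ 2 * (m - 1) ^ 2 + 2 * ‖w - ζ‖ ^ 2 := by
        nlinarith [sq_nonneg (|m - 1| * R - ‖w - ζ‖), sq_abs (m - 1)]
      have h3 : c * (1 / 2 * ‖w - ζ‖ ^ 2) ≤ c * (m * ‖w - ζ‖ ^ 2) := by gcongr
      have h4 : c' * ‖z - ζ‖ ^ 2 ≤ c' * (2 * R ^ 2 * (m - 1) ^ 2 + 2 * ‖w - ζ‖ ^ 2) := by gcongr
      have h5 : c' * (2 * R ^ 2) * (m - 1) ^ 2 ≤ 1 * (m - 1) ^ 2 := by gcongr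
      have h6 : c' * ‖w - ζ‖ ^ 2 ≤ c / 2 * ‖w - ζ‖ ^ 2 := by gcongr
      linarith
    · have h1 : m * ‖w - ζ‖ ≤ (1 + b * R) * ‖z - ζ‖ := by
        have h2 : m • (w - ζ) = (z - ζ) - (m - 1) • ζ := by
          rw [smul_sub, ← hzw, sub_smul, one_smul]; abel
        have h3 : m * ‖w - ζ‖ = ‖m • (w - ζ)‖ := by
          rw [norm_smul, Real.norm_eq_abs, abs_of_nonneg hm0]
        rw [h3, h2]
        refine (norm_sub_le _ _).trans ?_
        rw [norm_smul, Real.norm_eq_abs]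
        have : |m - 1| * ‖ζ‖ ≤ (b * ‖z - ζ‖) * R := by gcongr
        linarith
      have h2 : (m * ‖w - ζ‖) ^ 2 ≤ ((1 + b * R) * ‖z - ζ‖) ^ 2 := by gcongr
      have h3 : m * ‖w - ζ‖ ^ 2 ≤ 2 * (m * ‖w - ζ‖) ^ 2 := by
        have h4 : 0 ≤ m * ‖w - ζ‖ ^ 2 * (2 * m - 1) :=
          mul_nonneg (by positivity) (by linarith)
        linarith
      have h4 := mul_le_mul_of_nonneg_left (h3.trans (mul_le_mul_of_nonneg_left h2 two_pos.le)) hC.le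
      have h6 : 0 ≤ 16 * C * R ^ 2 * b ^ 2 * ‖z - ζ‖ ^ 2 := by positivity
      linarith

/-- The squared gauge is uniformly strongly convex and uniformly smooth. -/
theorem exists_sq_gauge_pinching {D : Set E} (hD : IsOpen D) (hconv : Convex ℝ D)
    (hbdd : Bornology.IsBounded D) (h0 : (0 : E) ∈ D) {c C : ℝ} (hc : 0 < c) (hC : 0 < C)
    (h : ∀ ζ ∈ frontier D, ∃ l : E →L[ℝ] ℝ, l ζ = 1 ∧
      ∀ w ∈ frontier D, c * ‖w - ζ‖ ^ 2 ≤ 1 - l w ∧ 1 - l w ≤ C * ‖w - ζ‖ ^ 2) :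
    ∃ c' > 0, ∃ C' > 0, ∀ ζ, ∃ L : E →L[ℝ] ℝ, ∀ z,
      c' * ‖z - ζ‖ ^ 2 ≤ gauge D z ^ 2 - gauge D ζ ^ 2 - L (z - ζ) ∧
        gauge D z ^ 2 - gauge D ζ ^ 2 - L (z - ζ) ≤ C' * ‖z - ζ‖ ^ 2 := by
  have hnhds : D ∈ 𝓝 0 := hD.mem_nhds h0
  obtain ⟨a, ha, hlow⟩ : ∃ a > 0, ∀ z, a * ‖z‖ ≤ gauge D z := by
    obtain ⟨R, hR0, hR⟩ := hbdd.subset_closedBall_lt 0 (0 : E)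
    refine ⟨R⁻¹, by positivity, fun z => ?_⟩
    rw [inv_mul_eq_div]
    exact le_gauge_of_subset_closedBall (absorbent_nhds_zero hnhds) hR0.le hR
  obtain ⟨b, hb, hlip⟩ : ∃ b > 0, ∀ z w, |gauge D z - gauge D w| ≤ b * ‖z - w‖ := by
    obtain ⟨K, hK⟩ := hconv.lipschitz_gauge hnhds
    refine ⟨K + 1, by positivity, fun z w => ?_⟩
    have := hK.dist_le_mul z w
    rw [Real.dist_eq, dist_eq_norm] at this
    nlinarith [norm_nonneg (z - w)]
  obtain ⟨c', hc', C', hC', hmain⟩ :=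
    exists_sq_gauge_pinching_frontier hD hconv h0 ha hb hc hC hlow hlip
  refine ⟨min c' (a ^ 2), by positivity, max C' (b ^ 2), by positivity, fun ζ => ?_⟩
  rcases eq_or_ne ζ 0 with rfl | hζ
  · refine ⟨0, fun z => ?_⟩
    have h1 := hlow z
    have h2 := hlip z 0
    rw [gauge_zero, sub_zero, sub_zero, abs_of_nonneg (gauge_nonneg z)] at h2
    simp only [gauge_zero, sub_zero, zero_apply, ne_eq, OfNat.ofNat_ne_zero,
      not_false_eq_true, zero_pow]
    constructor
    · calc min c' (a ^ 2) * ‖z‖ ^ 2 ≤ a ^ 2 * ‖z‖ ^ 2 := by gcongr; exact min_le_right _ _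
        _ = (a * ‖z‖) ^ 2 := by ring
        _ ≤ _ := by gcongr
    · calc gauge D z ^ 2 ≤ (b * ‖z‖) ^ 2 := by gcongr; exact gauge_nonneg z
        _ = b ^ 2 * ‖z‖ ^ 2 := by ring
        _ ≤ _ := by gcongr; exact le_max_right _ _
  · set t := gauge D ζ with ht
    have ht0 : 0 < t := lt_of_lt_of_le (mul_pos ha (norm_pos_iff.2 hζ)) (hlow ζ)
    have hfr : t⁻¹ • ζ ∈ frontier D := by
      rw [← gauge_eq_one_iff_mem_frontier hconv hnhds, gauge_smul_of_nonneg (by positivity),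
        smul_eq_mul, inv_mul_cancel₀ ht0.ne']
    obtain ⟨l, hl1, hl⟩ := h _ hfr
    -- Degree-two homogeneity reduces to the boundary point $t^{-1}\zeta$: both sides scale by
    -- $t^2$, so the constants do not change.
    refine ⟨(2 * t) • l, fun z => ?_⟩
    obtain ⟨h1, h2⟩ := hmain _ hfr l hl1 hl (t⁻¹ • z)
    rw [← smul_sub, norm_smul, gauge_smul_of_nonneg (by positivity), map_smul, smul_eq_mul,
      smul_eq_mul, Real.norm_eq_abs, abs_of_pos (by positivity)] at h1 h2
    have e1 : gauge D z ^ 2 - t ^ 2 - ((2 * t) • l) (z - ζ) =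
        t ^ 2 * ((t⁻¹ * gauge D z) ^ 2 - 1 - 2 * (t⁻¹ * l (z - ζ))) := by
      rw [smul_apply, smul_eq_mul]; field_simp
    have e2 : t ^ 2 * (t⁻¹ * ‖z - ζ‖) ^ 2 = ‖z - ζ‖ ^ 2 := by field_simp
    rw [e1]
    have h1' := mul_le_mul_of_nonneg_left h1 (sq_nonneg t)
    have h2' := mul_le_mul_of_nonneg_left h2 (sq_nonneg t)
    have i1 : min c' (a ^ 2) * ‖z - ζ‖ ^ 2 ≤ c' * ‖z - ζ‖ ^ 2 := by gcongr; exact min_le_left _ _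
    have i2 : C' * ‖z - ζ‖ ^ 2 ≤ max C' (b ^ 2) * ‖z - ζ‖ ^ 2 := by gcongr; exact le_max_left _ _
    rw [← e2] at i1 i2 ⊢
    constructor <;> linarith

end Gauge

/-! ### Part (a): size of the kernel. -/

section Kernel

variable {n : ℕ}

theorem bilin_smul_right (a v : Cn n) (c : ℂ) : bilin a (c • v) = c * bilin a v := by
  simp only [bilin, PiLp.smul_apply, smul_eq_mul, Finset.mul_sum]
  exact Finset.sum_congr rfl fun j _ => by ring

theorem re_bilin_holGrad (f : Cn n → ℝ) (ζ v : Cn n) :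
    (bilin (holGrad f ζ) v).re = fderiv ℝ f ζ v / 2 := by
  have hv : v = ∑ j, ((v j).re • EuclideanSpace.single j (1 : ℂ) +
      (v j).im • EuclideanSpace.single j Complex.I) := by
    ext i
    simp [PiLp.add_apply, Finset.sum_add_distrib, Pi.single_apply, Complex.re_add_im]
  conv_rhs => rw [hv]
  simp only [map_sum, map_add, map_smul, smul_eq_mul, bilin, holGrad, Complex.re_sum,
    Finset.sum_div]
  refine Finset.sum_congr rfl fun j _ => ?_
  simp [Complex.mul_re]
  ring

/-- By complex linearity of the pairing, its imaginary part is a real derivative in the direction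
$iv$; this is what the volume estimates use. -/
theorem im_bilin_holGrad (f : Cn n → ℝ) (ζ v : Cn n) :
    (bilin (holGrad f ζ) v).im = -fderiv ℝ f ζ (Complex.I • v) / 2 := by
  rw [neg_div, ← re_bilin_holGrad, bilin_smul_right]
  simp

/-- Strong convexity with uniformly bounded second differences. -/
def IsQuadraticallyPinched (f : Cn n → ℝ) (c C : ℝ) : Prop :=
  Differentiable ℝ f ∧ ∀ ζ z, c * ‖z - ζ‖ ^ 2 ≤ f z - f ζ - fderiv ℝ f ζ (z - ζ) ∧
    f z - f ζ - fderiv ℝ f ζ (z - ζ) ≤ C * ‖z - ζ‖ ^ 2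

/-- A functional with quadratic remainder must be the derivative, so pinching itself yields
differentiability everywhere, including at the origin. -/
theorem IsStronglyConvexDomain.exists_pinched {D : Set (Cn n)} (hD : IsStronglyConvexDomain D)
    (hbdd : Bornology.IsBounded D) (h0 : (0 : Cn n) ∈ D) :
    Convex ℝ D ∧ ∃ c > 0, ∃ C > 0, IsQuadraticallyPinched (rhoD D) c C := by
  obtain ⟨r, hr, hDr, hpos⟩ := hD.exists_definingFunction
  obtain ⟨hconv, c₀, hc₀, C₀, hC₀, hl⟩ := convex_and_exists_support hD.isOpen
    hD.isConnected.isPreconnected hbdd h0 hr hDr fun z hz => (hpos z hz).2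
  refine ⟨hconv, ?_⟩
  obtain ⟨c, hc, C, hC, h⟩ := exists_sq_gauge_pinching hD.isOpen hconv hbdd h0 hc₀ hC₀ hl
  have key : ∀ ζ, ∃ L : Cn n →L[ℝ] ℝ, HasFDerivAt (rhoD D) L ζ ∧ ∀ z,
      c * ‖z - ζ‖ ^ 2 ≤ rhoD D z - rhoD D ζ - L (z - ζ) ∧
        rhoD D z - rhoD D ζ - L (z - ζ) ≤ C * ‖z - ζ‖ ^ 2 := by
    intro ζ
    obtain ⟨L, hL⟩ := h ζ
    have hL' : ∀ z, c * ‖z - ζ‖ ^ 2 ≤ rhoD D z - rhoD D ζ - L (z - ζ) ∧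
        rhoD D z - rhoD D ζ - L (z - ζ) ≤ C * ‖z - ζ‖ ^ 2 := fun z => by
      simpa [rhoD] using hL z
    refine ⟨L, hasFDerivAt_of_abs_sub_le_sq (C := C) fun z => ?_, hL'⟩
    rw [abs_of_nonneg (le_trans (by positivity) (hL' z).1)]
    exact (hL' z).2
  refine ⟨c, hc, C, hC, fun ζ => ?_, fun ζ z => ?_⟩
  · obtain ⟨L, hL, -⟩ := key ζ
    exact hL.differentiableAt
  · obtain ⟨L, hL, h⟩ := key ζ
    rw [hL.fderiv]
    exact h z

theorem rhoD_nonpos {D : Set (Cn n)} (hconv : Convex ℝ D) (hnhds : D ∈ 𝓝 0) {z : Cn n}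
    (hz : z ∈ closure D) : rhoD D z ≤ 0 := by
  have h1 := (gauge_le_one_iff_mem_closure hconv hnhds).2 hz
  have h2 : 0 ≤ gauge D z := gauge_nonneg z
  rw [rhoD]
  nlinarith

theorem rhoD_neg {D : Set (Cn n)} (hD : IsOpen D) (hconv : Convex ℝ D) (hnhds : D ∈ 𝓝 0) {z : Cn n}
    (hz : z ∈ D) : rhoD D z < 0 := by
  have h1 := (gauge_lt_one_iff_mem_interior hconv hnhds).2 (hD.interior_eq.symm ▸ hz)
  have h2 : 0 ≤ gauge D z := gauge_nonneg z
  rw [rhoD]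
  nlinarith

theorem continuous_rhoD {D : Set (Cn n)} (hconv : Convex ℝ D) (hnhds : D ∈ 𝓝 0) :
    Continuous (rhoD D) :=
  ((continuous_gauge hconv hnhds).pow 2).sub continuous_const

/-- The modulus of the kernel is comparable to an explicit quasi-distance. -/
theorem kerB_comparison {D : Set (Cn n)} (hconv : Convex ℝ D) (hnhds : D ∈ 𝓝 0) {c C : ℝ}
    (hc : 0 < c) (hC : 0 < C) (h : IsQuadraticallyPinched (rhoD D) c C) :
    ∃ C₁ C₂ : ℝ, 0 < C₁ ∧ 0 < C₂ ∧ ∀ ζ ∈ closure D, ∀ z ∈ closure D,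
      C₁ * (|rhoD D ζ| + |rhoD D z| + |(bilin (holGrad (rhoD D) ζ) (ζ - z)).im| + ‖ζ - z‖ ^ 2)
          ≤ ‖kerB D ζ z‖ ∧
      ‖kerB D ζ z‖ ≤
        C₂ * (|rhoD D ζ| + |rhoD D z| + |(bilin (holGrad (rhoD D) ζ) (ζ - z)).im| +
          ‖ζ - z‖ ^ 2) := by
  refine ⟨min 1 c / 4, max 1 C, by positivity, by positivity, fun ζ hζ z hz => ?_⟩
  have hρζ := rhoD_nonpos hconv hnhds hζ
  have hρz := rhoD_nonpos hconv hnhds hz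
  have him : (kerB D ζ z).im = (bilin (holGrad (rhoD D) ζ) (ζ - z)).im := by simp [kerB]
  have hre : (kerB D ζ z).re = fderiv ℝ (rhoD D) ζ (ζ - z) / 2 - rhoD D ζ := by
    rw [kerB, Complex.sub_re, re_bilin_holGrad, Complex.ofReal_re]
  -- Adding $-\rho(\zeta)-\rho(z)$ to the Taylor remainder bounded here gives exactly
  -- $2\operatorname{Re}B_D$.
  obtain ⟨h1, h2⟩ := h.2 ζ z
  have hneg : fderiv ℝ (rhoD D) ζ (z - ζ) = -fderiv ℝ (rhoD D) ζ (ζ - z) := by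
    rw [← map_neg, neg_sub]
  rw [hneg, norm_sub_rev] at h1 h2
  rw [abs_of_nonpos hρζ, abs_of_nonpos hρz, ← him]
  set B := kerB D ζ z
  have hX : 0 ≤ ‖ζ - z‖ ^ 2 := by positivity
  have hre1 : |B.re| ≤ ‖B‖ := Complex.abs_re_le_norm B
  have him1 : |B.im| ≤ ‖B‖ := Complex.abs_im_le_norm B
  have hB : ‖B‖ ≤ |B.re| + |B.im| := Complex.norm_le_abs_re_add_abs_im B
  have hre0 : 0 ≤ B.re := by rw [hre]; nlinarith
  rw [abs_of_nonneg hre0] at hre1 hB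
  have him0 := abs_nonneg B.im
  constructor
  · have k0 : 0 < min 1 c := by positivity
    have k1 : min 1 c * (-rhoD D ζ + -rhoD D z + |B.im|) ≤
        1 * (-rhoD D ζ + -rhoD D z + |B.im|) := by
      gcongr
      · linarith
      · exact min_le_left _ _
    have k2 : min 1 c * ‖ζ - z‖ ^ 2 ≤ c * ‖ζ - z‖ ^ 2 := by gcongr; exact min_le_right _ _
    linarith
  · have k1 : 1 * (-rhoD D ζ + -rhoD D z + |B.im|) ≤
        max 1 C * (-rhoD D ζ + -rhoD D z + |B.im|) := by
      gcongr
      · linarith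
      · exact le_max_left _ _
    have k2 : C * ‖ζ - z‖ ^ 2 ≤ max 1 C * ‖ζ - z‖ ^ 2 := by gcongr; exact le_max_right _ _
    have k3 : 0 ≤ C * ‖ζ - z‖ ^ 2 := by positivity
    linarith

/-- Smallness of the kernel in either order controls the same anisotropic quantities at `z`. -/
theorem exists_kerB_control {D : Set (Cn n)} (hconv : Convex ℝ D) (hnhds : D ∈ 𝓝 0) {c C : ℝ}
    (hc : 0 < c) (hC : 0 < C) (h : IsQuadraticallyPinched (rhoD D) c C) :
    ∃ A > 0, ∀ ζ ∈ closure D, ∀ z ∈ closure D, ∀ B : ℝ, (B = ‖kerB D ζ z‖ ∨ B = ‖kerB D z ζ‖) →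
      |rhoD D ζ| ≤ A * B ∧ |rhoD D z| ≤ A * B ∧
        |fderiv ℝ (rhoD D) z (Complex.I • (ζ - z))| ≤ A * B ∧ ‖ζ - z‖ ^ 2 ≤ A * B := by
  obtain ⟨C₁, C₂, hC₁, hC₂, hcomp⟩ := kerB_comparison hconv hnhds hc hC h
  refine ⟨(2 + 4 * C) / C₁, by positivity, ?_⟩
  have key : ∀ x y p t X B : ℝ, 0 ≤ x → 0 ≤ y → 0 ≤ t → 0 ≤ X → C₁ * (x + y + t / 2 + X) ≤ B →
      p ≤ t + 4 * C * X → x ≤ (2 + 4 * C) / C₁ * B ∧ y ≤ (2 + 4 * C) / C₁ * B ∧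
        p ≤ (2 + 4 * C) / C₁ * B ∧ X ≤ (2 + 4 * C) / C₁ * B := by
    intro x y p t X B hx hy ht hX hB hp
    have e1 : (2 + 4 * C) * (x + y + t / 2 + X) ≤ (2 + 4 * C) / C₁ * B := by
      rw [div_mul_eq_mul_div, le_div_iff₀ hC₁]
      have := mul_le_mul_of_nonneg_left hB (show 0 ≤ 2 + 4 * C by positivity)
      linarith
    have e2 := mul_nonneg hC.le hx
    have e3 := mul_nonneg hC.le hy
    have e4 := mul_nonneg hC.le ht
    have e5 := mul_nonneg hC.le hX
    refine ⟨?_, ?_, ?_, ?_⟩ <;> linarith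
  rintro ζ hζ z hz B (rfl | rfl)
  -- In this order the imaginary term involves $d\rho_\zeta$; replacing it by $d\rho_z$ costs
  -- $4C\|\zeta-z\|^2$, which the kernel already controls.
  · have hlip := abs_fderiv_sub_le_of_quadratic_pinching (f := rhoD D) (C := C)
      (fun x w => ⟨le_trans (by positivity) (h.2 x w).1, (h.2 x w).2⟩) ζ z (Complex.I • (ζ - z))
    rw [norm_smul, Complex.norm_I, one_mul] at hlip
    have h1 := (hcomp ζ hζ z hz).1
    rw [im_bilin_holGrad, abs_div, abs_neg, abs_two] at h1
    refine key _ _ _ _ _ _ (abs_nonneg _) (abs_nonneg _) (abs_nonneg _) (sq_nonneg _) h1 ?_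
    have := abs_sub_abs_le_abs_sub (fderiv ℝ (rhoD D) z (Complex.I • (ζ - z)))
      (fderiv ℝ (rhoD D) ζ (Complex.I • (ζ - z)))
    rw [abs_sub_comm] at this
    nlinarith
  · have h1 := (hcomp z hz ζ hζ).1
    rw [im_bilin_holGrad, abs_div, abs_neg, abs_two] at h1
    have hs : fderiv ℝ (rhoD D) z (Complex.I • (z - ζ)) =
        -fderiv ℝ (rhoD D) z (Complex.I • (ζ - z)) := by
      rw [← map_neg, ← smul_neg, neg_sub]
    rw [hs, abs_neg, norm_sub_rev] at h1
    rw [add_comm (|rhoD D z|)] at h1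
    refine key _ _ _ _ _ _ (abs_nonneg _) (abs_nonneg _) (abs_nonneg _) (sq_nonneg _) h1 ?_
    have : 0 ≤ 4 * C * ‖ζ - z‖ ^ 2 := by positivity
    linarith

end Kernel

/-! ### Volumes of thin sets and of boundary shells. -/

section Slab

open scoped Pointwise

variable {E : Type*} [NormedAddCommGroup E] [NormedSpace ℝ E] [FiniteDimensional ℝ E]
  [MeasurableSpace E] [BorelSpace E]

/-- A set of diameter `R` that is thin in two directions has small measure: it has many disjoint
translates in a ball of comparable radius. -/
theorem measure_le_of_thin_in_two_directions (μ : Measure E) [μ.IsAddHaarMeasure] {T : Set E}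
    (hT : MeasurableSet T) {z ν ν' : E} {Λ : E →L[ℝ] ℝ} {R M s u : ℝ} (hR : 0 < R) (hM : 0 ≤ M)
    (hs : 0 < s) (hu : 0 < u) (hν : ‖ν‖ ≤ M) (hν' : ‖ν'‖ ≤ M) (hball : T ⊆ Metric.closedBall z R)
    (hΛ : Λ ν = 0) (hΛ' : Λ ν' = 1) (hTs : ∀ a ∈ T, |Λ (a - z)| ≤ s)
    (hTu : ∀ a ∈ T, ∀ t : ℝ, 0 ≤ t → a + t • ν ∈ T → t ≤ u) :
    μ T ≤ ENNReal.ofReal (6 * (u * s / R ^ 2) * ((1 + 2 * M) * R) ^ Module.finrank ℝ E) *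
      μ (Metric.ball 0 1) := by
  -- Indices stop at the floor, so each shift coefficient is at most $R$; the extra $1$ makes the
  -- number of translates at least $R^2/(6us)$ even when $u$ or $s$ exceeds $R$.
  set J := ⌊R / (2 * u)⌋₊ + 1 with hJ
  set K := ⌊R / (3 * s)⌋₊ + 1 with hK
  have hJle : ∀ j ∈ Finset.range J, (j : ℝ) * (2 * u) ≤ R := by
    intro j hj
    rw [← le_div_iff₀ (by positivity)]
    refine le_trans ?_ (Nat.floor_le (by positivity))
    exact_mod_cast Nat.lt_succ_iff.1 (Finset.mem_range.1 hj)
  have hKle : ∀ k ∈ Finset.range K, (k : ℝ) * (3 * s) ≤ R := by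
    intro j hj
    rw [← le_div_iff₀ (by positivity)]
    refine le_trans ?_ (Nat.floor_le (by positivity))
    exact_mod_cast Nat.lt_succ_iff.1 (Finset.mem_range.1 hj)
  have hJge : R / (2 * u) ≤ J := by rw [hJ]; push_cast; exact (Nat.lt_floor_add_one _).le
  have hKge : R / (3 * s) ≤ K := by rw [hK]; push_cast; exact (Nat.lt_floor_add_one _).le
  -- `Λ` varies by at most $2s$ on `T`, so spacing $3s$ separates different `k`. For equal `k`,
  -- spacing $2u$ exceeds the extent of `T` along `ν`.
  let τ : ℕ × ℕ → E := fun p => (p.1 * (2 * u)) • ν + (p.2 * (3 * s)) • ν'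
  have hdisj : (↑(Finset.range J ×ˢ Finset.range K) : Set (ℕ × ℕ)).PairwiseDisjoint
      fun p => (fun a => τ p + a) '' T := by
    rintro ⟨j, k⟩ - ⟨j', k'⟩ - hne
    refine Set.disjoint_left.2 ?_
    rintro _ ⟨a, ha, rfl⟩ ⟨a', ha', heq⟩
    simp only [τ] at heq
    refine hne ?_
    have hk : k = k' := by
      have h1 := congrArg Λ heq
      simp only [map_add, map_smul, hΛ, hΛ', smul_eq_mul] at h1
      have h2 := hTs a ha
      have h3 := hTs a' ha'
      rw [map_sub, abs_le] at h2 h3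
      by_contra hkk
      rcases lt_or_gt_of_ne hkk with h | h
      · have : (k : ℝ) + 1 ≤ k' := by exact_mod_cast h
        nlinarith
      · have : (k' : ℝ) + 1 ≤ k := by exact_mod_cast h
        nlinarith
    subst hk
    have hmove : ∀ (i i' : ℕ) (b b' : E), b ∈ T → b' ∈ T →
        ((i' : ℝ) * (2 * u)) • ν + ((k : ℝ) * (3 * s)) • ν' + b' =
          ((i : ℝ) * (2 * u)) • ν + ((k : ℝ) * (3 * s)) • ν' + b → ¬ i' < i := by
      intro i i' b b' hb hb' h hlt
      have hi : (i' : ℝ) + 1 ≤ i := by exact_mod_cast hlt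
      have hb'' : b' = b + (((i : ℝ) - i') * (2 * u)) • ν := by
        have : b' = ((i : ℝ) * (2 * u)) • ν - ((i' : ℝ) * (2 * u)) • ν + b := by
          rw [← sub_eq_zero] at h ⊢
          rw [← h]; abel
        rw [this, sub_mul, sub_smul, add_comm]
      have := hTu b hb (((i : ℝ) - i') * (2 * u)) (by
        have : 0 ≤ (i : ℝ) - i' := by linarith
        positivity) (hb'' ▸ hb')
      nlinarith
    have h1 := hmove j j' a a' ha ha' heq
    have h2 := hmove j' j a' a ha' ha heq.symm
    exact Prod.ext (by simpa using le_antisymm (not_lt.1 h1) (not_lt.1 h2)) rfl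
  have hsub : (⋃ p ∈ Finset.range J ×ˢ Finset.range K, (fun a => τ p + a) '' T) ⊆
      Metric.closedBall z ((1 + 2 * M) * R) := by
    refine iUnion₂_subset ?_
    rintro ⟨j, k⟩ hp _ ⟨a, ha, rfl⟩
    rw [Finset.mem_product] at hp
    have h1 := hball ha
    rw [Metric.mem_closedBall, dist_eq_norm] at h1 ⊢
    have h2 : ‖((j : ℝ) * (2 * u)) • ν‖ ≤ R * M := by
      rw [norm_smul, Real.norm_eq_abs, abs_of_nonneg (by positivity)]
      exact mul_le_mul (hJle j hp.1) hν (norm_nonneg _) hR.le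
    have h3 : ‖((k : ℝ) * (3 * s)) • ν'‖ ≤ R * M := by
      rw [norm_smul, Real.norm_eq_abs, abs_of_nonneg (by positivity)]
      exact mul_le_mul (hKle k hp.2) hν' (norm_nonneg _) hR.le
    have h4 : τ (j, k) + a - z =
        ((j : ℝ) * (2 * u)) • ν + ((k : ℝ) * (3 * s)) • ν' + (a - z) := by
      simp only [τ]; abel
    simp only
    rw [h4]
    refine (norm_add₃_le).trans ?_
    linarith
  have hmeas := measure_mono (μ := μ) hsub
  rw [measure_biUnion_finset hdisj fun p _ => ?_] at hmeas
  swap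
  · exact (Homeomorph.addLeft (τ p)).isClosedEmbedding.measurableEmbedding.measurableSet_image.2 hT
  have htr : ∀ p, μ ((fun a => τ p + a) '' T) = μ T := fun p => by
    rw [image_add_left, measure_preimage_add]
  simp only [htr, Finset.sum_const, nsmul_eq_mul, Finset.card_product, Finset.card_range] at hmeas
  rw [Measure.addHaar_closedBall _ _ (by positivity)] at hmeas
  have hprod : R ^ 2 / (6 * (u * s)) ≤ (J : ℝ) * K := by
    calc R ^ 2 / (6 * (u * s)) = R / (2 * u) * (R / (3 * s)) := by field_simp; norm_num
      _ ≤ _ := by gcongr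
  have hone : (1 : ℝ≥0∞) ≤ ENNReal.ofReal (6 * (u * s / R ^ 2)) * ((J * K : ℕ) : ℝ≥0∞) := by
    rw [← ENNReal.ofReal_natCast, ← ENNReal.ofReal_mul (by positivity), ← ENNReal.ofReal_one]
    refine ENNReal.ofReal_le_ofReal ?_
    push_cast
    calc (1 : ℝ) = 6 * (u * s / R ^ 2) * (R ^ 2 / (6 * (u * s))) := by field_simp
      _ ≤ _ := by gcongr
  calc μ T ≤ (ENNReal.ofReal (6 * (u * s / R ^ 2)) * ((J * K : ℕ) : ℝ≥0∞)) * μ T :=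
        le_mul_of_one_le_left (zero_le) hone
    _ ≤ ENNReal.ofReal (6 * (u * s / R ^ 2)) *
        (ENNReal.ofReal (((1 + 2 * M) * R) ^ Module.finrank ℝ E) * μ (Metric.ball 0 1)) := by
        rw [mul_assoc]; gcongr
    _ = _ := by rw [← mul_assoc, ← ENNReal.ofReal_mul (by positivity)]

/-- The shell between an open convex set and its dilate has measure proportional to its width. -/
theorem measure_shell_le (μ : Measure E) [μ.IsAddHaarMeasure] {D : Set E} (hD : IsOpen D)
    (hconv : Convex ℝ D) (hbdd : Bornology.IsBounded D) (h0 : (0 : E) ∈ D) {d : ℕ}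
    (hd : Module.finrank ℝ E = 2 * d) {u : ℝ} (hu : 0 < u) :
    μ {ζ ∈ D | 1 - gauge D ζ ^ 2 ≤ u} ≤ ENNReal.ofReal ((d + 1) * u) * μ D := by
  rcases le_or_gt 1 u with h1 | h1
  · refine (measure_mono (sep_subset _ _)).trans (le_mul_of_one_le_left zero_le ?_)
    rw [← ENNReal.ofReal_one]
    refine ENNReal.ofReal_le_ofReal ?_
    have : (0 : ℝ) ≤ d * u := by positivity
    linarith
  -- The dilate $\theta D$ misses the shell and has measure $(1-u)^d\mu(D)\ge(1-du)\mu(D)$ by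
  -- Bernoulli.
  set θ := √(1 - u) with hθ
  have hθ0 : 0 < θ := Real.sqrt_pos.2 (by linarith)
  have hθ2 : θ ^ 2 = 1 - u := Real.sq_sqrt (by linarith)
  have hθ1 : θ ≤ 1 := by nlinarith
  have hg1 : ∀ ζ ∈ D, gauge D ζ < 1 := fun ζ hζ =>
    (gauge_lt_one_iff_mem_interior hconv (hD.mem_nhds h0)).2 (hD.interior_eq.symm ▸ hζ)
  have hdisj : Disjoint {ζ ∈ D | 1 - gauge D ζ ^ 2 ≤ u} (θ • D) := by
    refine Set.disjoint_left.2 ?_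
    rintro _ ⟨-, hz⟩ ⟨w, hw, rfl⟩
    simp only [gauge_smul_of_nonneg hθ0.le, smul_eq_mul, mul_pow, hθ2] at hz
    have h2 := hg1 w hw
    have h3 : gauge D w ^ 2 < 1 := by nlinarith [gauge_nonneg (s := D) w]
    nlinarith
  have hsub : {ζ ∈ D | 1 - gauge D ζ ^ 2 ≤ u} ∪ θ • D ⊆ D := by
    refine union_subset (sep_subset _ _) ?_
    rintro _ ⟨w, hw, rfl⟩
    exact hconv.smul_mem_of_zero_mem h0 hw ⟨hθ0.le, hθ1⟩
  have hle := measure_mono (μ := μ) hsub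
  rw [measure_union hdisj (hD.smul₀ hθ0.ne').measurableSet, Measure.addHaar_smul, hd,
    pow_mul, hθ2, abs_of_nonneg (by have : 0 ≤ 1 - u := by linarith
                                    positivity)] at hle
  have hfin : μ D ≠ ∞ := hbdd.measure_lt_top.ne
  have hb : 1 - d * u ≤ (1 - u) ^ d := by
    have := one_add_mul_le_pow (a := -u) (by linarith) d
    linarith [this, (by ring_nf : 1 + (d : ℝ) * -u = 1 - d * u),
      (by ring_nf : (1 + -u) ^ d = (1 - u) ^ d)]
  have hsum : μ D ≤ ENNReal.ofReal (d * u) * μ D + ENNReal.ofReal ((1 - u) ^ d) * μ D := by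
    rw [← add_mul, ← ENNReal.ofReal_add (by positivity) (pow_nonneg (by linarith) _)]
    refine le_mul_of_one_le_left zero_le ?_
    rw [← ENNReal.ofReal_one]
    exact ENNReal.ofReal_le_ofReal (by linarith)
  refine (ENNReal.le_of_add_le_add_right (ENNReal.mul_ne_top ENNReal.ofReal_ne_top hfin)
    (hle.trans hsum)).trans ?_
  gcongr
  linarith

end Slab

/-! ### Anisotropic volume estimates. -/

section Volume

variable {n : ℕ}

theorem finrank_real_Cn (n : ℕ) : Module.finrank ℝ (Cn n) = 2 * n := by
  rw [← Module.finrank_mul_finrank ℝ ℂ (Cn n), Complex.finrank_real_complex, finrank_euclideanSpace,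
    Fintype.card_fin]

/-- Anisotropic boxes of size `√s × s` intersected with a boundary layer of width `u` have volume
`O(u sⁿ)`. -/
theorem exists_volume_anisotropic_layer_le {D : Set (Cn n)} (hD : IsOpen D) (hconv : Convex ℝ D)
    (hbdd : Bornology.IsBounded D) (h0 : (0 : Cn n) ∈ D) {c C : ℝ}
    (hc : 0 < c) (hC : 0 < C) (h : IsQuadraticallyPinched (rhoD D) c C) :
    ∃ A > 0, ∀ z ∈ D, ∀ s > 0, ∀ u > 0, |rhoD D z| ≤ s →
      volume {ζ ∈ D | |rhoD D ζ| ≤ u ∧ |fderiv ℝ (rhoD D) z (Complex.I • (ζ - z))| ≤ s ∧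
        ‖ζ - z‖ ^ 2 ≤ s} ≤ ENNReal.ofReal (A * u * s ^ n) := by
  have hnhds := hD.mem_nhds h0
  obtain ⟨R, hR0, hR⟩ := hbdd.subset_closedBall_lt 0 (0 : Cn n)
  have hneg : ∀ ζ ∈ D, rhoD D ζ ≤ 0 := fun ζ hζ => rhoD_nonpos hconv hnhds (subset_closure hζ)
  have hρ0 : rhoD D 0 = -1 := by simp [rhoD]
  -- the two regimes are separated by `s₀`
  obtain ⟨s₀, hs₀, hs₀1, hs₀2⟩ : ∃ s₀ > 0, s₀ ≤ 1 / 2 ∧ 16 * C * R * √s₀ ≤ 1 := by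
    refine ⟨min (1 / 2) ((1 / (16 * C * R)) ^ 2), by positivity, min_le_left _ _, ?_⟩
    calc 16 * C * R * √(min (1 / 2) ((1 / (16 * C * R)) ^ 2))
        ≤ 16 * C * R * √((1 / (16 * C * R)) ^ 2) := by gcongr; exact min_le_right _ _
      _ = 1 := by rw [Real.sqrt_sq (by positivity)]; field_simp
  set V := volume.real (Metric.ball (0 : Cn n) 1) with hV
  set W := volume.real D with hW
  have hVfin : volume (Metric.ball (0 : Cn n) 1) = ENNReal.ofReal V :=
    (ENNReal.ofReal_toReal Metric.isBounded_ball.measure_lt_top.ne).symm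
  have hWfin : volume D = ENNReal.ofReal W := (ENNReal.ofReal_toReal hbdd.measure_lt_top.ne).symm
  have hV0 : 0 ≤ V := measureReal_nonneg
  have hW0 : 0 ≤ W := measureReal_nonneg
  refine ⟨6 * (1 + 2 * (4 * R)) ^ (2 * n) * V + (n + 1) * W / s₀ ^ n + 1, by positivity,
    fun z hz s hs u hu hzs => ?_⟩
  rcases le_or_gt s s₀ with hss | hss
  · have hrs : √s ^ 2 = s := Real.sq_sqrt hs.le
    have hrs0 : 0 < √s := Real.sqrt_pos.2 hs
    have hlip := abs_fderiv_sub_le_of_quadratic_pinching (f := rhoD D) (C := C)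
      (fun x w => ⟨le_trans (by positivity) (h.2 x w).1, (h.2 x w).2⟩)
    have hzR : ‖z‖ ≤ R := by simpa using hR hz
    -- Pinching at $z$ against the origin gives $d\rho_z(z)\ge1+\rho(z)\ge1/2$, so a bounded complex
    -- multiple of $z$ has pairing $1$. Then $d\rho_z(\nu)=2$ and $d\rho_z(i\nu)=0$: the two thin
    -- directions are $\nu$ and $i\nu$.
    obtain ⟨ν, hνR, hν1⟩ : ∃ ν : Cn n, ‖ν‖ ≤ 4 * R ∧ bilin (holGrad (rhoD D) z) ν = 1 := by
      have h1 := (h.2 z 0).1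
      rw [zero_sub, map_neg, hρ0] at h1
      have h2 : 1 / 4 ≤ (bilin (holGrad (rhoD D) z) z).re := by
        rw [re_bilin_holGrad]
        have : 0 ≤ c * ‖-z‖ ^ 2 := by positivity
        have := (abs_le.1 hzs).1
        linarith
      have h3 : 1 / 4 ≤ ‖bilin (holGrad (rhoD D) z) z‖ := h2.trans (Complex.re_le_norm _)
      have h4 : bilin (holGrad (rhoD D) z) z ≠ 0 := by
        rw [← norm_pos_iff]; linarith
      refine ⟨(bilin (holGrad (rhoD D) z) z)⁻¹ • z, ?_, ?_⟩
      · rw [norm_smul, norm_inv]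
        have : ‖bilin (holGrad (rhoD D) z) z‖⁻¹ ≤ 4 := by
          rw [inv_le_comm₀ (by linarith) (by norm_num)]; linarith
        gcongr
      · rw [bilin_smul_right, inv_mul_cancel₀ h4]
    have hdν : fderiv ℝ (rhoD D) z ν = 2 := by
      have := re_bilin_holGrad (rhoD D) z ν
      rw [hν1, Complex.one_re] at this; linarith
    have hdIν : fderiv ℝ (rhoD D) z (Complex.I • ν) = 0 := by
      have := im_bilin_holGrad (rhoD D) z ν
      rw [hν1, Complex.one_im] at this; linarith
    let J : Cn n →L[ℝ] Cn n := (Complex.I • ContinuousLinearMap.id ℝ (Cn n))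
    have hJ : ∀ v, J v = Complex.I • v := fun v => rfl
    have hcont := continuous_rhoD hconv hnhds
    have hmeas : MeasurableSet {ζ ∈ D | |rhoD D ζ| ≤ u ∧
        |fderiv ℝ (rhoD D) z (Complex.I • (ζ - z))| ≤ s ∧ ‖ζ - z‖ ^ 2 ≤ s} := by
      refine hD.measurableSet.inter (IsClosed.measurableSet ?_)
      have c1 : Continuous fun ζ => |rhoD D ζ| := hcont.abs
      have c2 : Continuous fun ζ => |fderiv ℝ (rhoD D) z (Complex.I • (ζ - z))| :=
        ((fderiv ℝ (rhoD D) z).continuous.comp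
          ((continuous_id.sub continuous_const).const_smul Complex.I)).abs
      have c3 : Continuous fun ζ : Cn n => ‖ζ - z‖ ^ 2 := by fun_prop
      exact (isClosed_le c1 continuous_const).inter
        ((isClosed_le c2 continuous_const).inter (isClosed_le c3 continuous_const))
    refine (measure_le_of_thin_in_two_directions volume hmeas (z := z) (ν := ν)
      (ν' := -(1 / 2 : ℝ) • J ν) (Λ := (fderiv ℝ (rhoD D) z).comp J) (R := √s)
      (M := 4 * R) (s := s) (u := u) hrs0 (by positivity) hs hu hνR ?_ ?_ ?_ ?_ ?_ ?_).trans ?_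
    · rw [norm_smul, hJ, norm_smul, Complex.norm_I, one_mul, norm_neg, Real.norm_eq_abs,
        abs_of_pos (by norm_num)]
      linarith [norm_nonneg ν]
    · rintro ζ ⟨-, -, -, hζ⟩
      rw [Metric.mem_closedBall, dist_eq_norm]
      exact Real.le_sqrt_of_sq_le hζ
    · rw [ContinuousLinearMap.comp_apply, hJ, hdIν]
    · rw [map_smul, ContinuousLinearMap.comp_apply, hJ, hJ, smul_smul, Complex.I_mul_I,
        neg_one_smul, map_neg, hdν]
      norm_num
    · rintro ζ ⟨-, -, hζ, -⟩
      exact hζ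
    -- By choice of `s₀`, $d\rho_a(\nu)\ge1$ throughout the box; convexity gives
    -- $0\ge\rho(a+t\nu)\ge-u+t$.
    · rintro a ⟨haD, hau, -, haz⟩ t ht ⟨htD, htu, -, -⟩
      have h1 := hlip a z ν
      have h2 : ‖a - z‖ ≤ √s₀ := (Real.le_sqrt_of_sq_le haz).trans (Real.sqrt_le_sqrt hss)
      have h3 : 4 * C * ‖a - z‖ * ‖ν‖ ≤ 4 * C * √s₀ * (4 * R) := by gcongr
      have h4 : 1 ≤ fderiv ℝ (rhoD D) a ν := by
        rw [hdν] at h1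
        have := (abs_le.1 h1).1
        linarith
      have h5 := (h.2 a (a + t • ν)).1
      rw [add_sub_cancel_left, map_smul, smul_eq_mul] at h5
      have h6 : 0 ≤ c * ‖t • ν‖ ^ 2 := by positivity
      have h7 := hneg _ htD
      have h8 := (abs_le.1 hau).1
      nlinarith
    · rw [hVfin, ← ENNReal.ofReal_mul (by positivity)]
      refine ENNReal.ofReal_le_ofReal ?_
      rw [finrank_real_Cn, mul_pow, pow_mul (√s), hrs, mul_div_assoc, div_self hs.ne']
      have e : 0 ≤ ((n + 1) * W / s₀ ^ n + 1) * u * s ^ n := by positivity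
      linarith
  -- For large $s$ the box is irrelevant: the shell bound suffices, as $s^n\ge s_0^n$.
  · calc volume {ζ ∈ D | |rhoD D ζ| ≤ u ∧ |fderiv ℝ (rhoD D) z (Complex.I • (ζ - z))| ≤ s ∧
          ‖ζ - z‖ ^ 2 ≤ s} ≤ volume {ζ ∈ D | 1 - gauge D ζ ^ 2 ≤ u} := by
          refine measure_mono fun ζ hζ => ⟨hζ.1, ?_⟩
          have := (abs_le.1 hζ.2.1).1
          rw [rhoD] at this
          linarith
      _ ≤ ENNReal.ofReal ((n + 1) * u) * volume D :=
          measure_shell_le volume hD hconv hbdd h0 (finrank_real_Cn n) hu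
      _ = ENNReal.ofReal ((n + 1) * u * W) := by
          rw [hWfin, ← ENNReal.ofReal_mul (by positivity)]
      _ ≤ _ := by
          refine ENNReal.ofReal_le_ofReal ?_
          have e1 : s₀ ^ n ≤ s ^ n := by gcongr
          have e2 : (n + 1) * u * W ≤ (n + 1) * W / s₀ ^ n * u * s ^ n := by
            calc (n + 1) * u * W = (n + 1) * W / s₀ ^ n * u * s₀ ^ n := by field_simp
              _ ≤ _ := by gcongr
          have e3 : 0 ≤ (6 * (1 + 2 * (4 * R)) ^ (2 * n) * V + 1) * u * s ^ n := by positivity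
          linarith

/-- Volume of sublevel sets of the kernel, in either variable, intersected with a boundary layer. -/
theorem exists_volume_kerB_le {D : Set (Cn n)} (hD : IsOpen D) (hconv : Convex ℝ D)
    (hbdd : Bornology.IsBounded D) (h0 : (0 : Cn n) ∈ D) {c C : ℝ}
    (hc : 0 < c) (hC : 0 < C) (h : IsQuadraticallyPinched (rhoD D) c C) :
    ∃ A > 0, ∀ B : Cn n → Cn n → ℝ,
      ((∀ ζ z, B ζ z = ‖kerB D ζ z‖) ∨ (∀ ζ z, B ζ z = ‖kerB D z ζ‖)) → ∀ z ∈ D,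
        (∀ ζ ∈ D, |rhoD D ζ| ≤ A * B ζ z ∧ |rhoD D z| ≤ A * B ζ z) ∧
        ∀ s > 0, ∀ u > 0,
          volume {ζ ∈ D | |rhoD D ζ| ≤ u ∧ B ζ z ≤ s} ≤ ENNReal.ofReal (A * u * s ^ n) := by
  have hnhds := hD.mem_nhds h0
  obtain ⟨A₁, hA₁, hcontrol⟩ := exists_kerB_control hconv hnhds hc hC h
  obtain ⟨A₂, hA₂, hvol⟩ := exists_volume_anisotropic_layer_le hD hconv hbdd h0 hc hC h
  refine ⟨max A₁ (A₂ * A₁ ^ n), by positivity, fun B hB z hz => ?_⟩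
  have hB0 : ∀ ζ, 0 ≤ B ζ z := fun ζ => by
    rcases hB with hB | hB <;> rw [hB] <;> exact norm_nonneg _
  have hctl : ∀ ζ ∈ D, _ := fun ζ hζ => hcontrol ζ (subset_closure hζ) z (subset_closure hz) (B ζ z)
    (hB.imp (fun h => h ζ z) fun h => h ζ z)
  refine ⟨fun ζ hζ => ?_, fun s hs u hu => ?_⟩
  · obtain ⟨h1, h2, -⟩ := hctl ζ hζ
    have : A₁ * B ζ z ≤ max A₁ (A₂ * A₁ ^ n) * B ζ z :=
      mul_le_mul_of_nonneg_right (le_max_left _ _) (hB0 ζ)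
    exact ⟨h1.trans this, h2.trans this⟩
  -- A point of the sublevel set supplies the hypothesis $|\rho(z)|\le A_1s$ of the box estimate.
  · rcases eq_empty_or_nonempty {ζ ∈ D | |rhoD D ζ| ≤ u ∧ B ζ z ≤ s} with he | ⟨ζ₀, hζ₀, -, hζ₀s⟩
    · rw [he, measure_empty]; exact zero_le
    have hle : ∀ ζ, B ζ z ≤ s → A₁ * B ζ z ≤ A₁ * s := fun ζ hζ => by gcongr
    have hzs : |rhoD D z| ≤ A₁ * s := (hctl ζ₀ hζ₀).2.1.trans (hle _ hζ₀s)
    refine le_trans (measure_mono ?_) ((hvol z hz (A₁ * s) (by positivity) u hu hzs).trans ?_)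
    · rintro ζ ⟨hζ, hζu, hζs⟩
      obtain ⟨-, -, h3, h4⟩ := hctl ζ hζ
      exact ⟨hζ, hζu, h3.trans (hle _ hζs), h4.trans (hle _ hζs)⟩
    · refine ENNReal.ofReal_le_ofReal ?_
      calc A₂ * u * (A₁ * s) ^ n = (A₂ * A₁ ^ n) * u * s ^ n := by rw [mul_pow]; ring
        _ ≤ _ := by gcongr; exact le_max_right _ _

end Volume

/-! ### Integral estimates and Schur's test. -/

section Integrals

variable {X : Type*} [MeasurableSpace X]

/-- Integral of a negative power by decomposition into geometric shells. -/
theorem lintegral_rpow_neg_le_of_geometric_cover {ν : Measure X} {g : X → ℝ} (hg : Measurable g)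
    {A G q a β : ℝ} (hA : 0 ≤ A) (hG : 0 < G) (hq : 0 < q) (hβ : 0 ≤ β) (hq1 : q ^ (a - β) < 1)
    (hcover : ∀ᵐ x ∂ν, ∃ j : ℕ, G * q ^ j / 2 ≤ g x ∧ g x ≤ G * q ^ j)
    (hν : ∀ s > 0, ν {x | g x ≤ s} ≤ ENNReal.ofReal (A * s ^ a)) :
    ∫⁻ x, ENNReal.ofReal (g x ^ (-β)) ∂ν ≤
      ENNReal.ofReal (A * 2 ^ β * G ^ (a - β) / (1 - q ^ (a - β))) := by
  have hs : ∀ j : ℕ, 0 < G * q ^ j := fun j => by positivity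
  have hq0 : 0 ≤ q ^ (a - β) := by positivity
  have hset : ∀ j : ℕ, MeasurableSet {x | g x ≤ G * q ^ j} := fun j =>
    measurableSet_le hg measurable_const
  -- The ratio `q` is free: shells shrink to zero when $q<1$ and grow when $q>1$. In both cases
  -- $q^{a-\beta}<1$ makes the series converge.
  calc ∫⁻ x, ENNReal.ofReal (g x ^ (-β)) ∂ν
      ≤ ∫⁻ x, ∑' j : ℕ, {x | g x ≤ G * q ^ j}.indicator
          (fun _ => ENNReal.ofReal ((G * q ^ j / 2) ^ (-β))) x ∂ν := by
        refine lintegral_mono_ae (hcover.mono fun x ⟨j, hj1, hj2⟩ => ?_)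
        refine le_trans ?_ (ENNReal.le_tsum j)
        rw [indicator_of_mem (show x ∈ {x | g x ≤ G * q ^ j} from hj2)]
        refine ENNReal.ofReal_le_ofReal ?_
        exact Real.rpow_le_rpow_of_nonpos (half_pos (hs j)) hj1 (neg_nonpos.2 hβ)
    _ = ∑' j : ℕ, ENNReal.ofReal ((G * q ^ j / 2) ^ (-β)) * ν {x | g x ≤ G * q ^ j} := by
        rw [lintegral_tsum fun j => (measurable_const.indicator (hset j)).aemeasurable]
        simp_rw [lintegral_indicator_const (hset _)]
    _ ≤ ∑' j : ℕ, ENNReal.ofReal (A * 2 ^ β * G ^ (a - β) * (q ^ (a - β)) ^ j) := by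
        refine ENNReal.tsum_le_tsum fun j => ?_
        refine (mul_le_mul_right (hν _ (hs j)) _).trans ?_
        rw [← ENNReal.ofReal_mul (by have := hs j; positivity)]
        refine ENNReal.ofReal_le_ofReal (le_of_eq ?_)
        rw [Real.div_rpow (hs j).le (by norm_num), Real.rpow_neg (by norm_num : (0 : ℝ) ≤ 2),
          div_inv_eq_mul, ← Real.rpow_natCast (q ^ (a - β)) j, ← Real.rpow_mul hq.le,
          mul_comm (a - β), Real.rpow_mul hq.le, Real.rpow_natCast]
        have h1 : (G * q ^ j) ^ (-β) * (G * q ^ j) ^ a = G ^ (a - β) * (q ^ j) ^ (a - β) := by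
          rw [← Real.rpow_add (hs j), ← Real.mul_rpow hG.le (by positivity)]
          congr 1; ring
        calc _ = A * 2 ^ β * ((G * q ^ j) ^ (-β) * (G * q ^ j) ^ a) := by ring
          _ = _ := by rw [h1]; ring
    _ = _ := by
        rw [← ENNReal.ofReal_tsum_of_nonneg (fun j => by positivity)
          ((summable_geometric_of_lt_one hq0 hq1).mul_left _), tsum_mul_left,
          tsum_geometric_of_lt_one hq0 hq1, div_eq_mul_inv]

/-- The Forelli–Rudin type integral estimate in abstract form. -/
theorem exists_lintegral_rpow_mul_rpow_le (n : ℕ) {A α : ℝ} (hA : 0 < A) (hα0 : 0 < α)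
    (hα1 : α < 1) :
    ∃ K > 0, ∀ (μ : Measure X) (δ B : X → ℝ), Measurable δ → Measurable B → ∀ d > 0,
      (∀ᵐ x ∂μ, 0 < δ x ∧ δ x ≤ A * B x ∧ d ≤ A * B x) →
      (∀ s > 0, ∀ u > 0, μ {x | δ x ≤ u ∧ B x ≤ s} ≤ ENNReal.ofReal (A * u * s ^ n)) →
      ∫⁻ x, ENNReal.ofReal (δ x ^ (-α)) * ENNReal.ofReal (B x ^ (-(n + 1 : ℝ))) ∂μ ≤
        ENNReal.ofReal (K * d ^ (-α)) := by
  have hq1 : (1 / 2 : ℝ) ^ (1 - α) < 1 :=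
    Real.rpow_lt_one (by norm_num) (by norm_num) (by linarith)
  have hq2 : (2 : ℝ) ^ ((n + 1 - α) - (n + 1) : ℝ) < 1 :=
    Real.rpow_lt_one_of_one_lt_of_neg (by norm_num) (by linarith)
  set K₁ := A * 2 ^ α * A ^ (1 - α) / (1 - (1 / 2) ^ (1 - α)) with hK₁
  have hK₁0 : 0 < K₁ := div_pos (by positivity) (by linarith)
  refine ⟨K₁ * 2 ^ (n + 1 : ℝ) * (2 / A) ^ (-α) / (1 - 2 ^ ((n + 1 - α) - (n + 1) : ℝ)),
    div_pos (by positivity) (by linarith), fun μ δ B hδ hB d hd hae hvol => ?_⟩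
  set w : X → ℝ≥0∞ := fun x => ENNReal.ofReal (δ x ^ (-α)) with hw
  have hwm : Measurable w := (hδ.pow_const (-α)).ennreal_ofReal
  -- Integrating out $\delta^{-\alpha}$ first, over shells descending from $\delta\le As$, turns the
  -- volume bound into growth $s^{n+1-\alpha}$ for the weighted measure.
  have step : ∀ s > 0, (μ.withDensity w) {x | B x ≤ s} ≤
      ENNReal.ofReal (K₁ * s ^ (n + 1 - α : ℝ)) := by
    intro s hs
    have hset : MeasurableSet {x | B x ≤ s} := measurableSet_le hB measurable_const
    rw [withDensity_apply _ hset]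
    refine (lintegral_rpow_neg_le_of_geometric_cover (ν := μ.restrict {x | B x ≤ s}) hδ
      (A := A * s ^ n) (G := A * s) (q := 1 / 2) (a := 1) (β := α) (by positivity) (by positivity)
      (by norm_num) hα0.le hq1 ?_ ?_).trans (ENNReal.ofReal_le_ofReal (le_of_eq ?_))
    · filter_upwards [ae_restrict_of_ae hae, ae_restrict_mem hset] with x hx hxs
      have hle : δ x ≤ A * s := hx.2.1.trans (mul_le_mul_of_nonneg_left hxs hA.le)
      obtain ⟨j, hj1, hj2⟩ := exists_nat_pow_near_of_lt_one (x := δ x / (A * s)) (y := 1 / 2)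
        (div_pos hx.1 (by positivity)) ((div_le_one (by positivity)).2 hle) (by norm_num)
        (by norm_num)
      rw [lt_div_iff₀ (by positivity)] at hj1
      rw [div_le_iff₀ (by positivity)] at hj2
      refine ⟨j, ?_, by linarith⟩
      rw [pow_succ] at hj1
      linarith
    · intro u hu
      rw [Measure.restrict_apply (measurableSet_le hδ measurable_const), Real.rpow_one]
      exact (hvol s hs u hu).trans (ENNReal.ofReal_le_ofReal (by linarith))
    · rw [hK₁, Real.mul_rpow hA.le hs.le]
      have : s ^ (n + 1 - α : ℝ) = s ^ n * s ^ (1 - α) := by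
        rw [← Real.rpow_natCast s n, ← Real.rpow_add hs]; congr 1; ring
      rw [this]; ring
  -- Now shells ascend from the minimum $d/A$ of `B`; the factor $2$ offsets the half in the
  -- covering condition.
  have h2 := lintegral_rpow_neg_le_of_geometric_cover (ν := μ.withDensity w) hB
      (A := K₁) (G := 2 * (d / A)) (q := 2) (a := n + 1 - α) (β := n + 1) hK₁0.le (by positivity)
      (by norm_num) (by positivity) hq2 ?_ step
  · rw [lintegral_withDensity_eq_lintegral_mul _ hwm
      (hB.pow_const _).ennreal_ofReal] at h2
    refine h2.trans (ENNReal.ofReal_le_ofReal (le_of_eq ?_))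
    have e1 : (n + 1 - α - (n + 1) : ℝ) = -α := by ring
    have e2 : 2 * (d / A) = 2 / A * d := by ring
    rw [e1, e2, Real.mul_rpow (by positivity) hd.le]
    ring
  · refine (withDensity_absolutelyContinuous μ w).ae_le ?_
    filter_upwards [hae] with x hx
    have hle : 1 ≤ B x / (d / A) := by
      rw [le_div_iff₀ (by positivity), one_mul, div_le_iff₀ hA]; linarith [hx.2.2]
    obtain ⟨j, hj1, hj2⟩ := exists_nat_pow_near hle (one_lt_two)
    rw [le_div_iff₀ (by positivity)] at hj1
    rw [div_lt_iff₀ (by positivity), pow_succ] at hj2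
    exact ⟨j, by linarith, by linarith⟩

/-- Schur's test. -/
theorem lintegral_rpow_le_of_schur {μ : Measure X} [SFinite μ] {p q : ℝ} (hpq : p.HolderConjugate q)
    {K : X → X → ℝ≥0∞} (hK : Measurable (Function.uncurry K)) {h : X → ℝ≥0∞} (hh : Measurable h)
    (h0 : ∀ᵐ x ∂μ, h x ≠ 0) (htop : ∀ᵐ x ∂μ, h x ≠ ∞) {C₁ C₂ : ℝ≥0∞}
    (H₁ : ∀ᵐ z ∂μ, ∫⁻ ζ, K ζ z * h ζ ^ q ∂μ ≤ C₁ * h z ^ q)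
    (H₂ : ∀ᵐ ζ ∂μ, ∫⁻ z, K ζ z * h z ^ p ∂μ ≤ C₂ * h ζ ^ p)
    {f : X → ℝ≥0∞} (hf : AEMeasurable f μ) :
    ∫⁻ z, (∫⁻ ζ, f ζ * K ζ z ∂μ) ^ p ∂μ ≤ C₁ ^ (p / q) * C₂ * ∫⁻ ζ, f ζ ^ p ∂μ := by
  wlog hfm : Measurable f generalizing f
  · have e := hf.ae_eq_mk
    have e1 : ∀ z, ∫⁻ ζ, f ζ * K ζ z ∂μ = ∫⁻ ζ, hf.mk f ζ * K ζ z ∂μ := fun z =>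
      lintegral_congr_ae (e.mono fun ζ hζ => by simp only [hζ])
    have e2 : ∫⁻ ζ, f ζ ^ p ∂μ = ∫⁻ ζ, hf.mk f ζ ^ p ∂μ :=
      lintegral_congr_ae (e.mono fun ζ hζ => by simp only [hζ])
    simp only [e1, e2]
    exact this hf.measurable_mk.aemeasurable hf.measurable_mk
  have hp0 : 0 < p := hpq.pos
  have hq0 : 0 < q := hpq.symm.pos
  have hKl : ∀ z, Measurable fun ζ => K ζ z := fun z => hK.of_uncurry_right
  have pointwise : ∀ᵐ z ∂μ, (∫⁻ ζ, f ζ * K ζ z ∂μ) ^ p ≤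
      C₁ ^ (p / q) * ∫⁻ ζ, (h ζ)⁻¹ ^ p * f ζ ^ p * (K ζ z * h z ^ p) ∂μ := by
    filter_upwards [H₁] with z hz
    -- Hölder is applied to $K^{1/q}h\cdot K^{1/p}h^{-1}f$.
    have e1 : ∫⁻ ζ, f ζ * K ζ z ∂μ =
        ∫⁻ ζ, ((fun ζ => K ζ z ^ (1 / q) * h ζ) * fun ζ => K ζ z ^ (1 / p) * ((h ζ)⁻¹ * f ζ)) ζ ∂μ := by
      refine lintegral_congr_ae ?_
      filter_upwards [h0, htop] with ζ hζ0 hζt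
      have e2 : K ζ z = K ζ z ^ (1 / q) * K ζ z ^ (1 / p) := by
        rw [← ENNReal.rpow_add_of_nonneg _ _ (by positivity) (by positivity),
          one_div, one_div, hpq.symm.inv_add_inv_eq_one, ENNReal.rpow_one]
      calc f ζ * K ζ z = f ζ * (K ζ z ^ (1 / q) * K ζ z ^ (1 / p)) * (h ζ * (h ζ)⁻¹) := by
            rw [← e2, ENNReal.mul_inv_cancel hζ0 hζt, mul_one]
        _ = _ := by simp only [Pi.mul_apply]; ring
    have hold := ENNReal.lintegral_mul_le_Lp_mul_Lq μ hpq.symm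
      (f := fun ζ => K ζ z ^ (1 / q) * h ζ) (g := fun ζ => K ζ z ^ (1 / p) * ((h ζ)⁻¹ * f ζ))
      ((((hKl z).pow_const _).mul hh).aemeasurable)
      ((((hKl z).pow_const _).mul (hh.inv.mul hfm)).aemeasurable)
    rw [← e1] at hold
    have e3 : ∀ ζ, (K ζ z ^ (1 / q) * h ζ) ^ q = K ζ z * h ζ ^ q := fun ζ => by
      rw [ENNReal.mul_rpow_of_nonneg _ _ hq0.le, ← ENNReal.rpow_mul, one_div,
        inv_mul_cancel₀ hq0.ne', ENNReal.rpow_one]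
    have e4 : ∀ ζ, (K ζ z ^ (1 / p) * ((h ζ)⁻¹ * f ζ)) ^ p = (h ζ)⁻¹ ^ p * f ζ ^ p * K ζ z :=
      fun ζ => by
        rw [ENNReal.mul_rpow_of_nonneg _ _ hp0.le, ← ENNReal.rpow_mul, one_div,
          inv_mul_cancel₀ hp0.ne', ENNReal.rpow_one, ENNReal.mul_rpow_of_nonneg _ _ hp0.le]
        ring
    simp only [e3, e4] at hold
    calc (∫⁻ ζ, f ζ * K ζ z ∂μ) ^ p
        ≤ ((C₁ * h z ^ q) ^ (1 / q) *
            (∫⁻ ζ, (h ζ)⁻¹ ^ p * f ζ ^ p * K ζ z ∂μ) ^ (1 / p)) ^ p := by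
          refine ENNReal.rpow_le_rpow (hold.trans ?_) hp0.le
          exact mul_le_mul_left (ENNReal.rpow_le_rpow hz (by positivity)) _
      _ = C₁ ^ (p / q) * (h z ^ p * ∫⁻ ζ, (h ζ)⁻¹ ^ p * f ζ ^ p * K ζ z ∂μ) := by
          rw [ENNReal.mul_rpow_of_nonneg _ _ hp0.le, ← ENNReal.rpow_mul, ← ENNReal.rpow_mul,
            one_div_mul_cancel hp0.ne', ENNReal.rpow_one,
            ENNReal.mul_rpow_of_nonneg _ _ (by positivity), ← ENNReal.rpow_mul,
            show 1 / q * p = p / q by ring, show q * (p / q) = p by field_simp, mul_assoc]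
      _ = _ := by
          have hmz : Measurable fun ζ => (h ζ)⁻¹ ^ p * f ζ ^ p * K ζ z :=
            ((hh.inv.pow_const p).mul (hfm.pow_const p)).mul (hKl z)
          rw [← lintegral_const_mul _ hmz]
          congr 1
          exact lintegral_congr fun ζ => by ring
  have hm : Measurable (Function.uncurry fun z ζ =>
      (h ζ)⁻¹ ^ p * f ζ ^ p * (K ζ z * h z ^ p)) :=
    (((hh.inv.pow_const p).mul (hfm.pow_const p)).comp measurable_snd).mul
      ((hK.comp measurable_swap).mul ((hh.pow_const p).comp measurable_fst))
  calc ∫⁻ z, (∫⁻ ζ, f ζ * K ζ z ∂μ) ^ p ∂μ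
      ≤ ∫⁻ z, C₁ ^ (p / q) * ∫⁻ ζ, (h ζ)⁻¹ ^ p * f ζ ^ p * (K ζ z * h z ^ p) ∂μ ∂μ :=
        lintegral_mono_ae pointwise
    _ = C₁ ^ (p / q) * ∫⁻ ζ, ∫⁻ z, (h ζ)⁻¹ ^ p * f ζ ^ p * (K ζ z * h z ^ p) ∂μ ∂μ := by
        have hmi : Measurable fun z => ∫⁻ ζ, (h ζ)⁻¹ ^ p * f ζ ^ p * (K ζ z * h z ^ p) ∂μ :=
          hm.lintegral_prod_right'
        rw [lintegral_const_mul _ hmi, lintegral_lintegral_swap hm.aemeasurable]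
    _ ≤ C₁ ^ (p / q) * ∫⁻ ζ, C₂ * f ζ ^ p ∂μ := by
        refine mul_le_mul_right (lintegral_mono_ae ?_) _
        filter_upwards [h0, htop, H₂] with ζ hζ0 hζt hζ
        have hmζ : Measurable fun z => K ζ z * h z ^ p := hK.of_uncurry_left.mul (hh.pow_const p)
        rw [lintegral_const_mul _ hmζ]
        calc (h ζ)⁻¹ ^ p * f ζ ^ p * ∫⁻ z, K ζ z * h z ^ p ∂μ
            ≤ (h ζ)⁻¹ ^ p * f ζ ^ p * (C₂ * h ζ ^ p) := mul_le_mul_right hζ _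
          _ = C₂ * f ζ ^ p * ((h ζ)⁻¹ * h ζ) ^ p := by
              rw [ENNReal.mul_rpow_of_nonneg _ _ hp0.le]; ring
          _ = _ := by rw [ENNReal.inv_mul_cancel hζ0 hζt, ENNReal.one_rpow, mul_one]
    _ = _ := by rw [lintegral_const_mul _ (hfm.pow_const p), mul_assoc]

end Integrals

/-! ### Part (b): the operator on $L^p$. -/

section Operator

variable {n : ℕ}

theorem measurable_kerB {D : Set (Cn n)} (hρ : Measurable (rhoD D)) :
    Measurable fun x : Cn n × Cn n => kerB D x.1 x.2 := by
  have hgrad : ∀ j, Measurable fun ζ => holGrad (rhoD D) ζ j := fun j =>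
    (((Complex.measurable_ofReal.comp (measurable_fderiv_apply_const ℝ (rhoD D) _)).sub
      ((Complex.measurable_ofReal.comp
        (measurable_fderiv_apply_const ℝ (rhoD D) _)).const_mul Complex.I)).div_const 2)
  have hcoord : ∀ j, Measurable fun x : Cn n × Cn n => (x.1 - x.2) j := fun j => by
    have : Continuous fun x : Cn n × Cn n => (x.1 - x.2) j := by fun_prop
    exact this.measurable
  exact (Finset.measurable_fun_sum _ fun j _ => ((hgrad j).comp measurable_fst).mul (hcoord j)).sub
    (Complex.measurable_ofReal.comp (hρ.comp measurable_fst))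

theorem absKer_eq_rpow (D : Set (Cn n)) (ζ z : Cn n) :
    absKer D ζ z = ‖kerB D ζ z‖ ^ (-(n + 1 : ℝ)) := by
  rw [absKer, ← Real.rpow_intCast]
  congr 1
  push_cast; ring

theorem measurable_absKer {D : Set (Cn n)} (hρ : Measurable (rhoD D)) :
    Measurable fun x : Cn n × Cn n => absKer D x.1 x.2 := by
  simp only [absKer_eq_rpow]
  exact (measurable_kerB hρ).norm.pow_const _

theorem absKer_nonneg (D : Set (Cn n)) (ζ z : Cn n) : 0 ≤ absKer D ζ z :=
  zpow_nonneg (norm_nonneg _) _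

/-- The weighted integrals of the kernel required by Schur's test, in either variable. -/
theorem exists_lintegral_absKer_mul_rpow_le {D : Set (Cn n)} (hD : IsOpen D) (hconv : Convex ℝ D)
    (hbdd : Bornology.IsBounded D) (h0 : (0 : Cn n) ∈ D) {c C : ℝ}
    (hc : 0 < c) (hC : 0 < C) (h : IsQuadraticallyPinched (rhoD D) c C) {α : ℝ} (hα0 : 0 < α)
    (hα1 : α < 1) :
    ∃ K > 0, ∀ z ∈ D,
      ∫⁻ ζ in D, ENNReal.ofReal (absKer D ζ z) * ENNReal.ofReal (|rhoD D ζ| ^ (-α)) ≤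
        ENNReal.ofReal (K * |rhoD D z| ^ (-α)) ∧
      ∫⁻ ζ in D, ENNReal.ofReal (absKer D z ζ) * ENNReal.ofReal (|rhoD D ζ| ^ (-α)) ≤
        ENNReal.ofReal (K * |rhoD D z| ^ (-α)) := by
  have hnhds := hD.mem_nhds h0
  have hρ := (continuous_rhoD hconv hnhds).measurable
  obtain ⟨A, hA, hvol⟩ := exists_volume_kerB_le hD hconv hbdd h0 hc hC h
  obtain ⟨K, hK, hint⟩ := exists_lintegral_rpow_mul_rpow_le (X := Cn n) n hA hα0 hα1
  refine ⟨K, hK, fun z hz => ?_⟩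
  have main : ∀ B : Cn n → Cn n → ℝ, (∀ z, Measurable fun ζ => B ζ z) →
      ((∀ ζ z, B ζ z = ‖kerB D ζ z‖) ∨ (∀ ζ z, B ζ z = ‖kerB D z ζ‖)) →
      ∫⁻ ζ in D, ENNReal.ofReal (B ζ z ^ (-(n + 1 : ℝ))) * ENNReal.ofReal (|rhoD D ζ| ^ (-α)) ≤
        ENNReal.ofReal (K * |rhoD D z| ^ (-α)) := by
    intro B hBm hB
    refine (lintegral_congr fun ζ => mul_comm _ _).trans_le ?_
    obtain ⟨h1, h2⟩ := hvol B hB z hz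
    refine hint (volume.restrict D) (fun ζ => |rhoD D ζ|) (fun ζ => B ζ z) hρ.abs (hBm z)
      |rhoD D z| (abs_pos.2 (rhoD_neg hD hconv hnhds hz).ne) ?_ fun s hs u hu => ?_
    · filter_upwards [ae_restrict_mem hD.measurableSet] with ζ hζ
      exact ⟨abs_pos.2 (rhoD_neg hD hconv hnhds hζ).ne, h1 ζ hζ⟩
    · rw [Measure.restrict_apply' hD.measurableSet, inter_comm]
      exact h2 s hs u hu
  simp only [absKer_eq_rpow]
  exact ⟨main (fun ζ z => ‖kerB D ζ z‖)
      (fun z => ((measurable_kerB hρ).comp measurable_prodMk_right).norm)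
      (Or.inl fun _ _ => rfl),
    main (fun ζ z => ‖kerB D z ζ‖)
      (fun z => ((measurable_kerB hρ).comp measurable_prodMk_left).norm)
      (Or.inr fun _ _ => rfl)⟩

/-- Boundedness of the positive operator on `L^p`, for lower Lebesgue integrals. -/
theorem exists_lintegral_absKer_rpow_le {D : Set (Cn n)} (hD : IsOpen D) (hconv : Convex ℝ D)
    (hbdd : Bornology.IsBounded D) (h0 : (0 : Cn n) ∈ D) {c C : ℝ}
    (hc : 0 < c) (hC : 0 < C) (h : IsQuadraticallyPinched (rhoD D) c C) {p : ℝ} (hp : 1 < p) :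
    ∃ M : ℝ≥0∞, M ≠ ∞ ∧ ∀ f : Cn n → ℝ≥0∞, AEMeasurable f (volume.restrict D) →
      ∫⁻ z in D, (∫⁻ ζ in D, f ζ * ENNReal.ofReal (absKer D ζ z)) ^ p ≤
        M * ∫⁻ ζ in D, f ζ ^ p := by
  have hnhds := hD.mem_nhds h0
  have hρ := (continuous_rhoD hconv hnhds).measurable
  have hpq : p.HolderConjugate p.conjExponent := Real.HolderConjugate.conjExponent hp
  set q := p.conjExponent
  have hp0 : 0 < p := hpq.pos
  have hq0 : 0 < q := hpq.symm.pos
  have hαp : 1 / p < 1 := (div_lt_one hp0).2 hp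
  have hαq : 1 / q < 1 := (div_lt_one hq0).2 hpq.symm.lt
  obtain ⟨K₁, hK₁, h₁⟩ := exists_lintegral_absKer_mul_rpow_le hD hconv hbdd h0 hc hC h
    (one_div_pos.2 hp0) hαp
  obtain ⟨K₂, hK₂, h₂⟩ := exists_lintegral_absKer_mul_rpow_le hD hconv hbdd h0 hc hC h
    (one_div_pos.2 hq0) hαq
  -- This exponent makes $w^q=|\rho|^{-1/p}$ and $w^p=|\rho|^{-1/q}$, both in the admissible range
  -- $0<\alpha<1$.
  set w : Cn n → ℝ≥0∞ := fun ζ => ENNReal.ofReal (|rhoD D ζ| ^ (-(1 / (p * q)))) with hw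
  have hwq : ∀ ζ, w ζ ^ q = ENNReal.ofReal (|rhoD D ζ| ^ (-(1 / p))) := fun ζ => by
    rw [hw, ENNReal.ofReal_rpow_of_nonneg (by positivity) hq0.le, ← Real.rpow_mul (abs_nonneg _)]
    congr 2
    field_simp
  have hwp : ∀ ζ, w ζ ^ p = ENNReal.ofReal (|rhoD D ζ| ^ (-(1 / q))) := fun ζ => by
    rw [hw, ENNReal.ofReal_rpow_of_nonneg (by positivity) hp0.le, ← Real.rpow_mul (abs_nonneg _)]
    congr 2
    field_simp
  refine ⟨ENNReal.ofReal K₁ ^ (p / q) * ENNReal.ofReal K₂,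
    ENNReal.mul_ne_top (ENNReal.rpow_ne_top_of_nonneg (by positivity) ENNReal.ofReal_ne_top)
      ENNReal.ofReal_ne_top, fun f hf => ?_⟩
  refine lintegral_rpow_le_of_schur hpq (K := fun ζ z => ENNReal.ofReal (absKer D ζ z))
    (measurable_absKer hρ).ennreal_ofReal (h := w) (hρ.abs.pow_const _).ennreal_ofReal ?_
    (Filter.Eventually.of_forall fun _ => ENNReal.ofReal_ne_top) ?_ ?_ hf
  all_goals filter_upwards [ae_restrict_mem hD.measurableSet] with z hz
  · have hpos : 0 < |rhoD D z| := abs_pos.2 (rhoD_neg hD hconv hnhds hz).ne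
    exact (ENNReal.ofReal_pos.2 (by positivity)).ne'
  · simp only [hwq]
    rw [← ENNReal.ofReal_mul hK₁.le]
    exact (h₁ z hz).1
  · simp only [hwp]
    rw [← ENNReal.ofReal_mul hK₂.le]
    exact (h₂ z hz).2

/-- For fixed $z\in D$, $|B_D(\zeta,z)|\ge|\rho(z)|/A$ makes the kernel bounded in $\zeta$, and
$L^p(D)\subset L^1(D)$ since $D$ has finite measure. -/
theorem integrableOn_mul_absKer {D : Set (Cn n)} (hD : IsOpen D) (hconv : Convex ℝ D)
    (hbdd : Bornology.IsBounded D) (h0 : (0 : Cn n) ∈ D) {c C : ℝ}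
    (hc : 0 < c) (hC : 0 < C) (h : IsQuadraticallyPinched (rhoD D) c C) {p : ℝ≥0∞} (hp : 1 ≤ p)
    {f : Cn n → ℂ} (hf : MemLp f p (volume.restrict D)) {z : Cn n} (hz : z ∈ D) :
    IntegrableOn (fun ζ => f ζ * (absKer D ζ z : ℂ)) D volume := by
  have hnhds := hD.mem_nhds h0
  have hρ := (continuous_rhoD hconv hnhds).measurable
  have : IsFiniteMeasure (volume.restrict D) := ⟨by
    rw [Measure.restrict_apply_univ]; exact hbdd.measure_lt_top⟩
  obtain ⟨A, hA, hcontrol⟩ := exists_kerB_control hconv hnhds hc hC h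
  have hpos : 0 < |rhoD D z| := abs_pos.2 (rhoD_neg hD hconv hnhds hz).ne
  refine (hf.integrable hp).mul_bdd (c := (|rhoD D z| / A) ^ (-(n + 1 : ℝ))) ?_ ?_
  · exact (Complex.measurable_ofReal.comp
      ((measurable_absKer hρ).comp measurable_prodMk_right)).aestronglyMeasurable
  · filter_upwards [ae_restrict_mem hD.measurableSet] with ζ hζ
    have hle := (hcontrol ζ (subset_closure hζ) z (subset_closure hz) _ (Or.inl rfl)).2.1
    rw [Complex.norm_real, Real.norm_eq_abs, abs_of_nonneg (absKer_nonneg D ζ z), absKer_eq_rpow]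
    refine Real.rpow_le_rpow_of_nonpos (by positivity) ?_ (by linarith [n.cast_nonneg (α := ℝ)])
    rw [div_le_iff₀ hA]
    linarith

theorem aestronglyMeasurable_integral_mul_kernel {X : Type*} [MeasurableSpace X] {μ : Measure X}
    [SFinite μ] {f : X → ℂ} (hf : AEStronglyMeasurable f μ) {K : X × X → ℂ} (hK : Measurable K) :
    AEStronglyMeasurable (fun z => ∫ ζ, f ζ * K (ζ, z) ∂μ) μ := by
  have hF : AEStronglyMeasurable (fun x : X × X => f x.2 * K (x.2, x.1)) (μ.prod μ) :=
    hf.comp_snd.mul (hK.comp measurable_swap).aestronglyMeasurable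
  exact hF.integral_prod_right'

theorem aestronglyMeasurable_absOpB {D : Set (Cn n)} (hρ : Measurable (rhoD D)) {f : Cn n → ℂ}
    (hf : AEStronglyMeasurable f (volume.restrict D)) :
    AEStronglyMeasurable (absOpB D f) (volume.restrict D) :=
  aestronglyMeasurable_integral_mul_kernel hf (Complex.measurable_ofReal.comp (measurable_absKer hρ))

theorem enorm_absOpB_le (D : Set (Cn n)) (f : Cn n → ℂ) (z : Cn n) :
    ‖absOpB D f z‖ₑ ≤ ∫⁻ ζ in D, ‖f ζ‖ₑ * ENNReal.ofReal (absKer D ζ z) := by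
  refine (enorm_integral_le_lintegral_enorm _).trans (le_of_eq (lintegral_congr fun ζ => ?_))
  rw [enorm_mul, ← ofReal_norm (absKer D ζ z : ℂ), Complex.norm_real, Real.norm_eq_abs,
    abs_of_nonneg (absKer_nonneg D ζ z)]

end Operator

theorem lemma3p1 (n : ℕ) (hn : 1 ≤ n) (D : Set (Cn n)) (hD : IsStronglyConvexDomain D)
    (hbdd : Bornology.IsBounded D) (h0 : (0 : Cn n) ∈ D) :
    (∃ C₁ C₂ : ℝ, 0 < C₁ ∧ 0 < C₂ ∧ ∀ ζ ∈ closure D, ∀ z ∈ closure D,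
      C₁ * (|rhoD D ζ| + |rhoD D z| + |(bilin (holGrad (rhoD D) ζ) (ζ - z)).im| + ‖ζ - z‖ ^ 2)
          ≤ ‖kerB D ζ z‖ ∧
      ‖kerB D ζ z‖ ≤
        C₂ * (|rhoD D ζ| + |rhoD D z| + |(bilin (holGrad (rhoD D) ζ) (ζ - z)).im| + ‖ζ - z‖ ^ 2)) ∧
    ∀ p : ℝ≥0∞, 1 < p → p < ∞ → ∃ C : ℝ≥0, ∀ f : Cn n → ℂ, MemLp f p (volume.restrict D) →
      (∀ z ∈ D, IntegrableOn (fun ζ => f ζ * (absKer D ζ z : ℂ)) D volume) ∧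
      MemLp (absOpB D f) p (volume.restrict D) ∧
      eLpNorm (absOpB D f) p (volume.restrict D) ≤ C * eLpNorm f p (volume.restrict D) := by
  obtain ⟨hconv, c, hc, C, hC, h⟩ := hD.exists_pinched hbdd h0
  have hopen := hD.isOpen
  have hnhds := hopen.mem_nhds h0
  refine ⟨kerB_comparison hconv hnhds hc hC h, fun p hp1 hpt => ?_⟩
  have hp0 : p ≠ 0 := (zero_lt_one.trans hp1).ne'
  have hP : 1 < p.toReal := by
    rw [← ENNReal.toReal_one]
    exact (ENNReal.toReal_lt_toReal ENNReal.one_ne_top hpt.ne).2 hp1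
  obtain ⟨M, hM, hbound⟩ := exists_lintegral_absKer_rpow_le hopen hconv hbdd h0 hc hC h hP
  have hMtop : M ^ (1 / p.toReal) ≠ ∞ := ENNReal.rpow_ne_top_of_nonneg (by positivity) hM
  refine ⟨(M ^ (1 / p.toReal)).toNNReal, fun f hf => ?_⟩
  have hle : eLpNorm (absOpB D f) p (volume.restrict D) ≤
      (M ^ (1 / p.toReal)).toNNReal * eLpNorm f p (volume.restrict D) := by
    rw [ENNReal.coe_toNNReal hMtop, eLpNorm_eq_lintegral_rpow_enorm_toReal hp0 hpt.ne,
      eLpNorm_eq_lintegral_rpow_enorm_toReal hp0 hpt.ne,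
      ← ENNReal.mul_rpow_of_nonneg _ _ (by positivity)]
    refine ENNReal.rpow_le_rpow ?_ (by positivity)
    refine (lintegral_mono fun z => ?_).trans (hbound (fun ζ => ‖f ζ‖ₑ) hf.1.enorm)
    exact ENNReal.rpow_le_rpow (enorm_absOpB_le D f z) (by positivity)
  exact ⟨fun z hz => integrableOn_mul_absKer hopen hconv hbdd h0 hc hC h hp1.le hf hz,
    ⟨aestronglyMeasurable_absOpB (continuous_rhoD hconv hnhds).measurable hf.1,
      hle.trans_lt (ENNReal.mul_lt_top ENNReal.coe_lt_top hf.2)⟩, hle⟩
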